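/- Let $f_0,f_1,\dots,f_m:\mathbb R^n\to\mathbb R$ be twice continuously differentiable, $I=\{1,\dots,m\}$, $g_j=\nabla f_j$, and consider the problem (NCP) of minimizing $f_0(x)$ subject to $f_j(x)\le 0$, $j\in I$. Put $\varphi(x)=\max\{0,f_j(x):j\in I\}$; $\bar f_j(x)=f_j(x)$ if $f_j(x)\le 0$ and $\bar f_j(x)=f_j(x)-\varphi(x)$ if $f_j(x)>0$; $I(x)=\{j\in I:\bar f_j(x)=0\}$. Assume that for every $x\in\mathbb R^n$ the vectors $g_j(x)$, $j\in I(x)$, are linearly independent. Fix parameters $\gamma,\eta,\varepsilon\in(0,1)$, $0<\theta<\sigma<1$, $0<\varrho<\sigma$, $\xi,\zeta>0$, $\alpha\in(0,\tfrac12)$, $\rho>1$, $\delta>2$, $\tau\in(2,3)$. Given $x^k$ and a symmetric positive definite matrix $B_k$, write $\varphi_k=\varphi(x^k)$; an iteration of the algorithm is as follows. 1. $d_0^k$ is the minimizer of $g_0(x^k)^Td+\frac12 d^TB_kd$ subject to $\bar f_j(x^k)+g_j(x^k)^Td\le 0$, $j\in I$, and $\lambda^k\in\mathbb R^m$ is a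 corresponding KKT multiplier vector. If $d_0^k=0$ and $\varphi_k=0$, stop. 2. Let $D_j^k=|\bar f_j(x^k)|\,(|\bar f_j(x^k)+g_j(x^k)^Td_0^k|+\|d_0^k\|)$, and for $r\in\mathbb R^m$ consider the linear system $(S_r)$ in $(d,h)\in\mathbb R^n\times\mathbb R^m$: $B_kd+\sum_{j\in I}h_jg_j(x^k)=0$ and $g_j(x^k)^Td-D_j^kh_j=r_j$, $j\in I$. Let $(d_1^k,h_1^k)$ solve $(S_r)$ with $r_j=-(\|d_0^k\|^\tau+\varphi_k^\sigma)-\big(f_j(x^k+d_0^k)-f_j(x^k)-g_j(x^k)^Td_0^k\big)$, let $(\tilde d^k,\tilde h^k)$ solve $(S_r)$ with $r_j=-(\|d_0^k\|+\varphi_k^\sigma)$, and let $q^k=(1-\beta_k)d_0^k+\beta_k\tilde d^k$, where $\beta_k=1$ if $g_0(x^k)^T\tilde d^k\le g_0(x^k)^Td_0^k$, and otherwise $\beta_k=\min\Big\{1,\frac{(\theta-1)g_0(x^k)^Td_0^k+\varphi_k^\theta}{g_0(x^k)^T\tilde d^k-g_0(x^k)^Td_0^k}\Big\}$. 3. Let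 $d=d_0^k+d_1^k$. If $g_0(x^k)^Td_0^k\le\zeta\min\{-\|d_0^k\|^\delta,-\|d\|^\delta\}+\xi\varphi_k^\varrho$, and some $t\in\{1,\frac12,\frac14,\dots\}$ with $t\ge\varepsilon$ satisfies $f_0(x^k+td)\le f_0(x^k)+\alpha t\,g_0(x^k)^Td_0^k+\rho(1-\alpha)t\varphi_k^\theta$, $f_j(x^k+td)\le\varphi_k-\alpha t(\|d_0^k\|^\tau+\varphi_k^\sigma)$ for all $j\in I$ with $f_j(x^k)>0$, and $f_j(x^k+td)\le0$ for all $j\in I$ with $f_j(x^k)\le0$, then let $t_k$ be the first (largest) such $t$ and $d^k=d$. 4. Otherwise let $d^k=q^k$ and let $t_k$ be the first $t\in\{1,\eta,\eta^2,\dots\}$ with $f_0(x^k+tq^k)\le f_0(x^k)+\gamma t\,g_0(x^k)^Tq^k+\rho(1-\gamma)t\varphi_k^\theta$, $f_j(x^k+tq^k)\le\varphi_k-\gamma t\beta_k(\|d_0^k\|+\varphi_k^\sigma)$ for all $j\in I$ with $f_j(x^k)>0$, and $f_j(x^k+tq^k)\le0$ for all $j\in I$ with $f_j(x^k)\le 0$.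 5. $x^{k+1}=x^k+t_kd^k$, and $B_{k+1}$ is any symmetric positive definite matrix. Suppose that the algorithm, started at some $x^0\in\mathbb R^n$, does not stop, that there are $a,b>0$ with $a\|d\|^2\le d^TB_kd\le b\|d\|^2$ for all $d\in\mathbb R^n$ and all $k$, that $\{x^k\}$ is bounded, and that $x^*$ is an accumulation point of $\{x^k\}$ at which the strong second-order sufficient condition holds: for every KKT multiplier $\lambda$ of (NCP) at $x^*$, $d^T\nabla^2_{xx}L(x^*,\lambda)d>0$ for all $d\ne0$ with $g_j(x^*)^Td=0$ for each $j$ with $\lambda_j>0$, where $L(x,\lambda)=f_0(x)+\sum_{j\in I}\lambda_jf_j(x)$. Then: (i) $d_0^k$, $d_1^k$, $\tilde d^k$, $q^k$ and $d^k$ all tend to $0$, and $\|x^{k+1}-x^k\|\to0$, as $k\to\infty$; (ii) $x^k\to x^*$; (iii) $\varphi_k\to\varphi(x^*)=0$; moreover $x^*$ is a KKT point of (NCP) with a unique KKT multiplier $\lambda^*$, and $\lambda^k\to\lambda^*$. -/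

import Mathlib

open Filter Topology

noncomputable section

namespace SubfeasibleSQP

/-- `ℝⁿ` with its Euclidean inner product and norm. -/
abbrev E (n : ℕ) : Type := EuclideanSpace ℝ (Fin n)

/-- Minimize `obj x` subject to `con j x ≤ 0` for all `j`. -/
structure Problem (n m : ℕ) where
  obj : E n → ℝ
  con : Fin m → E n → ℝ

namespace Problem

variable {n m : ℕ} (P : Problem n m)

/-- Gradient of the objective. -/
def g₀ (x : E n) : E n := gradient P.obj x

/-- Gradients of the constraint functions. -/
def g (j : Fin m) (x : E n) : E n := gradient (P.con j) x

/-- The constraint violation `φ(x) = max {0, f_j(x) : j ∈ I}`. -/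
def phi (x : E n) : ℝ := Finset.univ.fold max 0 (fun j => P.con j x)

/-- `f̄_j(x)`: equal to `f_j(x)` if `f_j(x) ≤ 0` and to `f_j(x) - φ(x)` otherwise. -/
def conBar (j : Fin m) (x : E n) : ℝ :=
  if P.con j x ≤ 0 then P.con j x else P.con j x - P.phi x

/-- `I(x) = {j : f̄_j(x) = 0}`. -/
def active (x : E n) : Set (Fin m) := {j | P.conBar j x = 0}

/-- The constraint qualification: at every point the gradients indexed by `I(x)` are linearly
independent. -/
def GradientsIndependent : Prop :=
  ∀ x : E n, LinearIndependent ℝ (fun j : P.active x => P.g j x)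

/-- Karush-Kuhn-Tucker pairs. -/
structure IsKKTPair (x : E n) (lam : Fin m → ℝ) : Prop where
  stationary : P.g₀ x + ∑ j, lam j • P.g j x = 0
  feasible : ∀ j, P.con j x ≤ 0
  nonneg : ∀ j, 0 ≤ lam j
  complementary : ∀ j, lam j * P.con j x = 0

/-- `L(x, λ) = f₀(x) + ∑ⱼ λ_j f_j(x)`. -/
def lagrangian (lam : Fin m → ℝ) (x : E n) : ℝ := P.obj x + ∑ j, lam j * P.con j x

/-- The strong second-order sufficient condition at `(x, λ)`: the Hessian in `x` of the Lagrangian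
is positive definite on the orthogonal complement of the gradients with `λ_j > 0`. -/
def SSOSC (x : E n) (lam : Fin m → ℝ) : Prop :=
  ∀ d : E n, d ≠ 0 → (∀ j, 0 < lam j → inner ℝ (P.g j x) d = 0) →
    0 < fderiv ℝ (fderiv ℝ (P.lagrangian lam)) x d d

/-- The feasible set of the quadratic subproblem at `x`. -/
def qpFeasible (x : E n) : Set (E n) :=
  {d | ∀ j, P.conBar j x + inner ℝ (P.g j x) d ≤ 0}

/-- The objective `g₀(x)ᵀd + ½ dᵀBd` of the quadratic subproblem. -/
def qpObj (B : Matrix (Fin n) (Fin n) ℝ) (x d : E n) : ℝ :=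
  inner ℝ (P.g₀ x) d + (1 / 2) * inner ℝ d (B.toEuclideanLin d)

/-- `d₀` is an optimal solution of the quadratic subproblem at `x` with matrix `B`. -/
def IsQPSolution (B : Matrix (Fin n) (Fin n) ℝ) (x d₀ : E n) : Prop :=
  d₀ ∈ P.qpFeasible x ∧ ∀ d ∈ P.qpFeasible x, P.qpObj B x d₀ ≤ P.qpObj B x d

/-- `lam` is a KKT multiplier vector of the quadratic subproblem at its solution `d₀`. -/
structure IsQPMultiplier (B : Matrix (Fin n) (Fin n) ℝ) (x d₀ : E n) (lam : Fin m → ℝ) :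
    Prop where
  stationary : P.g₀ x + B.toEuclideanLin d₀ + ∑ j, lam j • P.g j x = 0
  nonneg : ∀ j, 0 ≤ lam j
  complementary : ∀ j, lam j * (P.conBar j x + inner ℝ (P.g j x) d₀) = 0

/-- `D_j = |f̄_j(x)| (|f̄_j(x) + g_j(x)ᵀd₀| + ‖d₀‖)`. -/
def diagD (x d₀ : E n) (j : Fin m) : ℝ :=
  |P.conBar j x| * (|P.conBar j x + inner ℝ (P.g j x) d₀| + ‖d₀‖)

/-- `(d, h)` solves the linear system with coefficient matrix `[[B, N], [Nᵀ, -diag D]]`, where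
`N = (g_j(x))_j`, and right-hand side `(0, r)`; the two block rows are written out. -/
def SolvesSLE (B : Matrix (Fin n) (Fin n) ℝ) (x d₀ : E n) (r : Fin m → ℝ)
    (d : E n) (h : Fin m → ℝ) : Prop :=
  B.toEuclideanLin d + ∑ j, h j • P.g j x = 0 ∧
    ∀ j, inner ℝ (P.g j x) d - P.diagD x d₀ j * h j = r j

/-- The remainder `F̃_j = f_j(x + d₀) - f_j(x) - g_j(x)ᵀd₀`. -/
def remainder (x d₀ : E n) (j : Fin m) : ℝ :=
  P.con j (x + d₀) - P.con j x - inner ℝ (P.g j x) d₀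

end Problem

/-- The parameters of the algorithm. -/
structure Params where
  (γ η ε θ σ ϱ ξ ζ α ρ δ τ : ℝ)
  γ_pos : 0 < γ
  γ_lt : γ < 1
  η_pos : 0 < η
  η_lt : η < 1
  ε_pos : 0 < ε
  ε_lt : ε < 1
  θ_pos : 0 < θ
  θ_lt : θ < σ
  σ_lt : σ < 1
  ϱ_pos : 0 < ϱ
  ϱ_lt : ϱ < σ
  ξ_pos : 0 < ξ
  ζ_pos : 0 < ζ
  α_pos : 0 < α
  α_lt : α < 1 / 2
  ρ_gt : 1 < ρ
  δ_gt : 2 < δ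
  τ_gt : 2 < τ
  τ_lt : τ < 3

section Tests

variable {n m : ℕ} (P : Problem n m) (p : Params)

/-- The largest `β ∈ [0, 1]` with
`(1 - β) g₀ᵀd₀ + β g₀ᵀd̃ ≤ θ g₀ᵀd₀ + φ(x)^θ`, by its explicit formula. -/
def beta (x d₀ dt : E n) : ℝ :=
  if inner ℝ (P.g₀ x) d₀ < inner ℝ (P.g₀ x) dt then
    min 1 (((p.θ - 1) * inner ℝ (P.g₀ x) d₀ + P.phi x ^ p.θ) /
      (inner ℝ (P.g₀ x) dt - inner ℝ (P.g₀ x) d₀))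
  else 1

/-- The test deciding whether the direction `d = d₀ + d₁` is tried. -/
def DirectionTest (x d₀ d : E n) : Prop :=
  inner ℝ (P.g₀ x) d₀ ≤
    p.ζ * min (-(‖d₀‖ ^ p.δ)) (-(‖d‖ ^ p.δ)) + p.ξ * P.phi x ^ p.ϱ

/-- The acceptance test for the step length `t` along `d = d₀ + d₁`. -/
def StepTestI (x d₀ d : E n) (t : ℝ) : Prop :=
  P.obj (x + t • d) ≤ P.obj x + p.α * t * inner ℝ (P.g₀ x) d₀
      + p.ρ * (1 - p.α) * t * P.phi x ^ p.θ ∧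
  (∀ j, 0 < P.con j x →
    P.con j (x + t • d) ≤ P.phi x - p.α * t * (‖d₀‖ ^ p.τ + P.phi x ^ p.σ)) ∧
  (∀ j, P.con j x ≤ 0 → P.con j (x + t • d) ≤ 0)

/-- The acceptance test for the step length `t` along `q`, with convex-combination weight `β`. -/
def StepTestII (x d₀ q : E n) (β t : ℝ) : Prop :=
  P.obj (x + t • q) ≤ P.obj x + p.γ * t * inner ℝ (P.g₀ x) q
      + p.ρ * (1 - p.γ) * t * P.phi x ^ p.θ ∧
  (∀ j, 0 < P.con j x →
    P.con j (x + t • q) ≤ P.phi x - p.γ * t * β * (‖d₀‖ + P.phi x ^ p.σ)) ∧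
  (∀ j, P.con j x ≤ 0 → P.con j (x + t • q) ≤ 0)

/-- The first cycle succeeds with step length `t`: the direction test holds and `t` is the first
of `1, 1/2, 1/4, …` passing the acceptance test, the search being given up below `ε`. -/
def CycleI (x d₀ d : E n) (t : ℝ) : Prop :=
  DirectionTest P p x d₀ d ∧
    ∃ i : ℕ, t = (1 / 2 : ℝ) ^ i ∧ p.ε ≤ t ∧ StepTestI P p x d₀ d t ∧
      ∀ i' < i, ¬ StepTestI P p x d₀ d ((1 / 2 : ℝ) ^ i')

/-- `t` is the first of `1, η, η², …` passing the acceptance test along `q`. -/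
def CycleII (x d₀ q : E n) (β t : ℝ) : Prop :=
  ∃ i : ℕ, t = p.η ^ i ∧ StepTestII P p x d₀ q β t ∧
    ∀ i' < i, ¬ StepTestII P p x d₀ q β (p.η ^ i')

end Tests

/-- The sequences occurring in an infinite run of the algorithm: iterates `x`, matrices `B`,
subproblem solutions `d₀` with multipliers `lam`, solutions `(d₁, h₁)` and `(dt, ht)` of the two
linear systems, convex combinations `q`, search directions `d` and step lengths `t`. -/
structure Sequences (n m : ℕ) where
  x : ℕ → E n
  B : ℕ → Matrix (Fin n) (Fin n) ℝ
  d₀ : ℕ → E n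
  lam : ℕ → Fin m → ℝ
  d₁ : ℕ → E n
  h₁ : ℕ → Fin m → ℝ
  dt : ℕ → E n
  ht : ℕ → Fin m → ℝ
  q : ℕ → E n
  d : ℕ → E n
  t : ℕ → ℝ

/-- `s` is generated by the algorithm without stopping. The vectors `dt k` and `q k` are used by
the algorithm only in the second cycle, but they are determined by their defining equations at
every iteration. The matrices `B k` are arbitrary symmetric positive definite ones. -/
structure IsGenerated {n m : ℕ} (P : Problem n m) (p : Params) (s : Sequences n m) : Prop where
  posDef : ∀ k, (s.B k).PosDef
  qp_solution : ∀ k, P.IsQPSolution (s.B k) (s.x k) (s.d₀ k)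
  qp_multiplier : ∀ k, P.IsQPMultiplier (s.B k) (s.x k) (s.d₀ k) (s.lam k)
  not_stopped : ∀ k, ¬ (s.d₀ k = 0 ∧ P.phi (s.x k) = 0)
  correction : ∀ k, P.SolvesSLE (s.B k) (s.x k) (s.d₀ k)
    (fun j => -(‖s.d₀ k‖ ^ p.τ + P.phi (s.x k) ^ p.σ) - P.remainder (s.x k) (s.d₀ k) j)
    (s.d₁ k) (s.h₁ k)
  updated : ∀ k, P.SolvesSLE (s.B k) (s.x k) (s.d₀ k)
    (fun _ => -(‖s.d₀ k‖ + P.phi (s.x k) ^ p.σ)) (s.dt k) (s.ht k)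
  combination : ∀ k, s.q k = (1 - beta P p (s.x k) (s.d₀ k) (s.dt k)) • s.d₀ k
    + beta P p (s.x k) (s.d₀ k) (s.dt k) • s.dt k
  search : ∀ k,
    (CycleI P p (s.x k) (s.d₀ k) (s.d₀ k + s.d₁ k) (s.t k) ∧ s.d k = s.d₀ k + s.d₁ k) ∨
    ((∀ t, ¬ CycleI P p (s.x k) (s.d₀ k) (s.d₀ k + s.d₁ k) t) ∧
      CycleII P p (s.x k) (s.d₀ k) (s.q k) (beta P p (s.x k) (s.d₀ k) (s.dt k)) (s.t k) ∧
      s.d k = s.q k)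
  step : ∀ k, s.x (k + 1) = s.x k + s.t k • s.d k

/-- Uniform positive definiteness of a sequence of matrices. -/
def UniformlyPosDef {n : ℕ} (B : ℕ → Matrix (Fin n) (Fin n) ℝ) : Prop :=
  ∃ a b : ℝ, 0 < a ∧ 0 < b ∧ ∀ (k : ℕ) (d : E n),
    a * ‖d‖ ^ 2 ≤ inner ℝ d ((B k).toEuclideanLin d) ∧
      inner ℝ d ((B k).toEuclideanLin d) ≤ b * ‖d‖ ^ 2

end SubfeasibleSQP

end

/-! Write `S = ‖d₀‖ + φ^σ` (`magnitude`) and `β` for the weight (`weight`). Because the active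
gradients are independent, the linear systems are solvable with bounds uniform in `B` and in the
diagonal entries (`exists_sle_bound`), so `‖dt‖` and `‖q‖` are `O(S)`. The explicit formula for `β`
gives `β ≥ cS` and `βS ≥ cφ^σ` (`exists_weight_ge`). The Taylor error `O(t²S²)` along `q` is then
dominated by the demanded decrease `tβS`, and a fixed small step is always accepted
(`exists_stepTestII`). Hence step lengths are bounded below.

Each iteration therefore lowers a positive violation by at least `cφ^σ`. As `σ < 1`, such a
recursion reaches zero in finitely many steps (`eventually_feasible`). From then on the `φ^θ` slack
in the objective tests vanishes, `f₀` decreases by at least `c‖d₀‖²` per step, and boundedness of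
the iterates forces `d₀ → 0` (`tendsto_d₀`). All other directions are controlled by `‖d₀‖` and `φ`.

Multipliers of the subproblems stay bounded thanks to a Slater direction
(`exists_multiplier_bound`), so every cluster point of the iterates is a KKT point. The strong
second-order condition isolates `xs` among KKT points (`eventually_not_isKKTPair`). A sequence with
vanishing steps converges to an isolated cluster point (`tendsto_of_isolated_mapClusterPt`).
Uniqueness of the multiplier at `xs` then gives convergence of `lam`. -/

namespace SubfeasibleSQP

/-! ### Topology, Taylor bounds and linear algebra. -/

section General

/-- A property depending monotonically on a constant and holding locally holds uniformly on
compact sets. -/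
theorem exists_uniform_of_local {X : Type*} [TopologicalSpace X] {K : Set X} (hK : IsCompact K)
    (Q : ℝ → X → Prop) (mono : ∀ C C' x, C ≤ C' → Q C x → Q C' x)
    (loc : ∀ x ∈ K, ∃ C, ∀ᶠ y in 𝓝 x, Q C y) : ∃ C, ∀ x ∈ K, Q C x := by
  refine hK.induction_on (p := fun s => ∃ C, ∀ x ∈ s, Q C x) ⟨0, by simp⟩ ?_ ?_ ?_
  · rintro s t hst ⟨C, hC⟩
    exact ⟨C, fun x hx => hC x (hst hx)⟩
  · rintro s t ⟨C, hC⟩ ⟨C', hC'⟩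
    refine ⟨max C C', ?_⟩
    rintro x (hx | hx)
    · exact mono _ _ _ (le_max_left _ _) (hC x hx)
    · exact mono _ _ _ (le_max_right _ _) (hC' x hx)
  · intro x hx
    obtain ⟨C, hC⟩ := loc x hx
    exact ⟨{y | Q C y}, mem_nhdsWithin_of_mem_nhds hC, C, fun y hy => hy⟩

/-- A sequence with vanishing steps converges to any cluster point that is isolated among its
cluster points. -/
theorem tendsto_of_isolated_mapClusterPt {X : Type*} [PseudoMetricSpace X] [ProperSpace X]
    {x : ℕ → X} {xs : X} (hstep : Tendsto (fun k => dist (x (k + 1)) (x k)) atTop (𝓝 0))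
    (hxs : MapClusterPt xs atTop x)
    (hiso : ∃ r > 0, ∀ y, 0 < dist y xs → dist y xs ≤ r → ¬ MapClusterPt y atTop x) :
    Tendsto x atTop (𝓝 xs) := by
  obtain ⟨r, hr, hiso⟩ := hiso
  rw [Metric.tendsto_atTop']
  intro e he
  set e' := min e r with he'
  have hpos : 0 < e' := lt_min he hr
  -- The compact annulus contains no cluster point, so it is visited finitely often; steps shorter
  -- than its width `e' / 2` cannot jump across it.
  have hout : ∀ᶠ k in atTop, ¬ (x k ∈ Metric.closedBall xs e' \ Metric.ball xs (e' / 2)) := by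
    by_contra hcon
    have hfr : ∃ᶠ k in atTop, x k ∈ Metric.closedBall xs e' \ Metric.ball xs (e' / 2) := by
      simpa [Filter.Frequently] using hcon
    have hcpt : IsCompact (Metric.closedBall xs e' \ Metric.ball xs (e' / 2)) :=
      (isCompact_closedBall xs e').diff Metric.isOpen_ball
    obtain ⟨y, hy, hcl⟩ := hcpt.exists_mapClusterPt_of_frequently hfr
    have h1 : dist y xs ≤ e' := hy.1
    have h2 : e' / 2 ≤ dist y xs := by simpa using hy.2
    exact hiso y (by linarith) (h1.trans (min_le_right _ _)) hcl
  have hsmall : ∀ᶠ k in atTop, dist (x (k + 1)) (x k) < e' / 2 :=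
    hstep.eventually (gt_mem_nhds (by positivity))
  obtain ⟨N, hN⟩ := eventually_atTop.1 (hout.and hsmall)
  have hfr := hxs.frequently (Metric.ball_mem_nhds xs (half_pos hpos))
  obtain ⟨k₀, hk₀, hin⟩ := (frequently_atTop.1 hfr) N
  have hin' : dist (x k₀) xs < e' / 2 := hin
  have key : ∀ k, k₀ ≤ k → dist (x k) xs < e' / 2 := by
    intro k hk
    induction k, hk using Nat.le_induction with
    | base => exact hin'
    | succ k hk ih =>
      have h1 := (hN k (hk₀.trans hk)).2
      have h2 := (hN (k + 1) (by omega)).1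
      have h3 := dist_triangle (x (k + 1)) (x k) xs
      by_contra hcon
      exact h2 ⟨by simp only [Metric.mem_closedBall]; linarith, by simpa using hcon⟩
  refine ⟨k₀, fun k hk => ?_⟩
  have h1 := key k hk.le
  have h2 : e' ≤ e := min_le_left _ _
  linarith

variable {F : Type*} [NormedAddCommGroup F] [InnerProductSpace ℝ F]

/-- Quadratic bound on the Taylor remainder of a `C²` function on a closed ball. -/
theorem exists_taylor_bound [FiniteDimensional ℝ F] {f : F → ℝ} (hf : ContDiff ℝ 2 f) (R : ℝ) :
    ∃ M, 0 < M ∧ ∀ x ∈ Metric.closedBall (0 : F) R, ∀ y ∈ Metric.closedBall (0 : F) R,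
      |f y - f x - inner ℝ (gradient f x) (y - x)| ≤ M * ‖y - x‖ ^ 2 := by
  have hF : ContDiff ℝ 1 (fderiv ℝ f) := hf.fderiv_right (by norm_num)
  have hc : Continuous (fderiv ℝ (fderiv ℝ f)) := hF.continuous_fderiv one_ne_zero
  obtain ⟨M, hM⟩ := (isCompact_closedBall (0 : F) R).exists_bound_of_continuousOn
    (f := fderiv ℝ (fderiv ℝ f)) hc.continuousOn
  have hM1 : ∀ x ∈ Metric.closedBall (0 : F) R, ‖fderiv ℝ (fderiv ℝ f) x‖ ≤ max M 1 :=
    fun x hx => (hM x hx).trans (le_max_left _ _)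
  have hpos : (0 : ℝ) < max M 1 := lt_max_of_lt_right one_pos
  refine ⟨max M 1, hpos, fun x hx y hy => ?_⟩
  have hlip : ∀ z ∈ Metric.closedBall (0 : F) R,
      ‖fderiv ℝ f z - fderiv ℝ f x‖ ≤ max M 1 * ‖z - x‖ := fun z hz =>
    Convex.norm_image_sub_le_of_norm_fderiv_le (𝕜 := ℝ)
      (fun w _ => (hF.differentiable one_ne_zero) w) hM1 (convex_closedBall _ _) hx hz
  have hseg : ∀ z ∈ segment ℝ x y, ‖fderiv ℝ f z - fderiv ℝ f x‖ ≤ max M 1 * ‖y - x‖ := by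
    intro z hz
    refine (hlip z ((convex_closedBall _ _).segment_subset hx hy hz)).trans ?_
    gcongr
    obtain ⟨t, ht, rfl⟩ := (segment_eq_image' ℝ x y ▸ hz)
    rw [add_sub_cancel_left, norm_smul, Real.norm_eq_abs, abs_of_nonneg ht.1]
    exact mul_le_of_le_one_left (norm_nonneg _) ht.2
  have := Convex.norm_image_sub_le_of_norm_hasFDerivWithin_le' (𝕜 := ℝ) (f := f)
    (f' := fderiv ℝ f) (φ := fderiv ℝ f x) (s := segment ℝ x y)
    (fun z _ => ((hf.differentiable two_ne_zero) z).hasFDerivAt.hasFDerivWithinAt) hseg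
    (convex_segment x y) (left_mem_segment ℝ x y) (right_mem_segment ℝ x y)
  rw [inner_gradient_left, ← Real.norm_eq_abs, sq, ← mul_assoc]
  exact this

theorem continuous_gradient [CompleteSpace F] {f : F → ℝ} (hf : ContDiff ℝ 2 f) :
    Continuous (gradient f) := by
  have : Continuous (fderiv ℝ f) := hf.continuous_fderiv two_ne_zero
  exact (InnerProductSpace.toDual ℝ F).symm.continuous.comp this

/-- A symmetric operator whose quadratic form lies between `0` and `b‖·‖²` has norm at most `b`. -/
theorem norm_apply_le_of_form_le {T : F →ₗ[ℝ] F} (hT : T.IsSymmetric) {b : ℝ}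
    (h0 : ∀ d, 0 ≤ inner ℝ d (T d)) (hb : ∀ d, inner ℝ d (T d) ≤ b * ‖d‖ ^ 2) (d : F) :
    ‖T d‖ ≤ b * ‖d‖ := by
  rcases eq_or_ne (T d) 0 with h | h
  · have := hb d
    have h0 := h0 d
    rcases eq_or_ne d 0 with hd | hd
    · simp [hd]
    · have hp : 0 < ‖d‖ := norm_pos_iff.2 hd
      rw [h, norm_zero]
      by_contra hcon
      nlinarith
  · have hp : 0 < ‖T d‖ := norm_pos_iff.2 h
    -- Polarization: the form at `d + s • T d` minus the form at `d - s • T d` is `4 * ‖d‖ * ‖T d‖`.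
    -- This scaling gives `s • T d` the norm of `d`.
    set s := ‖d‖ / ‖T d‖
    have hs : ‖s • T d‖ = ‖d‖ := by
      rw [norm_smul, Real.norm_of_nonneg (by positivity), div_mul_cancel₀ _ hp.ne']
    have h1 := hb (d + s • T d)
    have h2 := h0 (d - s • T d)
    have hsym : inner ℝ (s • T d) (T d) = inner ℝ d (T (s • T d)) := by
      rw [← hT d, real_inner_comm]
    have hval : inner ℝ (s • T d) (T d) = ‖d‖ * ‖T d‖ := by
      rw [real_inner_smul_left, real_inner_self_eq_norm_sq]
      rw [sq, ← mul_assoc, div_mul_cancel₀ _ hp.ne']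
    simp only [map_add, map_sub, inner_add_left, inner_add_right, inner_sub_left,
      inner_sub_right] at h1 h2
    rw [← hsym] at h1 h2
    rw [hval] at h1 h2
    have hdpos : 0 < ‖d‖ := norm_pos_iff.2 (fun hd => h (by simp [hd]))
    have hbnn : 0 ≤ b := by
      have := (h0 d).trans (hb d)
      by_contra hcon
      nlinarith [mul_pos hdpos hdpos]
    have h5 : 4 * (‖d‖ * ‖T d‖) ≤ b * ‖d + s • T d‖ ^ 2 := by linarith
    have h6 : ‖d + s • T d‖ ≤ 2 * ‖d‖ := (norm_add_le _ _).trans (by rw [hs]; linarith)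
    have h7 : ‖d + s • T d‖ ^ 2 ≤ 4 * ‖d‖ ^ 2 := by nlinarith [norm_nonneg (d + s • T d)]
    have h8 : 4 * (‖d‖ * ‖T d‖) ≤ b * (4 * ‖d‖ ^ 2) := h5.trans (by gcongr)
    by_contra hcon
    nlinarith

variable {ι : Type*} [Fintype ι]

/-- Linear independence of a subfamily in quantitative form, stable under perturbation. -/
theorem eventually_le_norm_sum_smul {X : Type*} [TopologicalSpace X] {v : ι → X → F} {x₀ : X}
    (hv : ∀ i, ContinuousAt (v i) x₀) (A : Set ι)
    (hA : LinearIndependent ℝ (fun i : A => v i x₀)) :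
    ∃ c > 0, ∀ᶠ x in 𝓝 x₀, ∀ h : ι → ℝ, (∀ i ∉ A, h i = 0) →
      c * ∑ i, |h i| ≤ ‖∑ i, h i • v i x‖ := by
  classical
  have hsum : ∀ h : ι → ℝ, (∀ i ∉ A, h i = 0) →
      ∑ i : A, h i • v i x₀ = ∑ i, h i • v i x₀ := by
    intro h hh
    rw [Finset.sum_set_coe (f := fun i => h i • v i x₀)]
    refine Finset.sum_subset (Finset.subset_univ _) fun i _ hi => ?_
    rw [hh i (by simpa using hi), zero_smul]
  let W : Submodule ℝ (ι → ℝ) :=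
    { carrier := {h | ∀ i ∉ A, h i = 0}
      add_mem' := fun ha hb i hi => by simp [ha i hi, hb i hi]
      zero_mem' := fun i _ => rfl
      smul_mem' := fun c a ha i hi => by simp [ha i hi] }
  let T : W →ₗ[ℝ] F := (Fintype.linearCombination ℝ (fun i => v i x₀)).domRestrict W
  have hTapp : ∀ h : W, T h = ∑ i, (h : ι → ℝ) i • v i x₀ := fun h => rfl
  -- On coefficients supported in `A` the combination map is injective, hence bounded below in
  -- finite dimension.
  have hker : LinearMap.ker T = ⊥ := by
    rw [LinearMap.ker_eq_bot']
    intro h hh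
    rw [hTapp, ← hsum h h.2] at hh
    have := Fintype.linearIndependent_iff.1 hA (fun i => (h : ι → ℝ) i) hh
    ext i
    by_cases hi : i ∈ A
    · exact this ⟨i, hi⟩
    · exact h.2 i hi
  obtain ⟨K, hK, hanti⟩ := T.exists_antilipschitzWith hker
  have hKpos : (0 : ℝ) < K := by exact_mod_cast hK
  set N : ℝ := Fintype.card ι + 1
  have hN : 0 < N := by positivity
  have hbase : ∀ h : ι → ℝ, (∀ i ∉ A, h i = 0) →
      1 / (K * N) * ∑ i, |h i| ≤ ‖∑ i, h i • v i x₀‖ := by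
    intro h hh
    have h1 : ‖h‖ ≤ K * ‖∑ i, h i • v i x₀‖ := by
      have := hanti.le_mul_dist ⟨h, hh⟩ 0
      rwa [dist_zero_right, map_zero, dist_zero_right] at this
    have h2 : ∑ i, |h i| ≤ N * ‖h‖ := by
      calc ∑ i, |h i| ≤ ∑ _i : ι, ‖h‖ := Finset.sum_le_sum fun i _ => norm_le_pi_norm h i
        _ = Fintype.card ι * ‖h‖ := by simp
        _ ≤ N * ‖h‖ := by gcongr; simp [N]
    rw [one_div, inv_mul_le_iff₀ (by positivity)]
    nlinarith
  -- Half of the constant at `x₀`; the other half absorbs the perturbation of the vectors.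
  set c := 1 / (K * N) / 2
  have hc : 0 < c := by positivity
  refine ⟨c, hc, ?_⟩
  have hev : ∀ᶠ x in 𝓝 x₀, ∀ i, ‖v i x - v i x₀‖ < c := by
    refine eventually_all.2 fun i => ?_
    have := (hv i).eventually (Metric.ball_mem_nhds (v i x₀) hc)
    simpa [dist_eq_norm] using this
  filter_upwards [hev] with x hx h hh
  have h1 := hbase h hh
  have h2 : ‖∑ i, h i • v i x₀‖ - ‖∑ i, h i • v i x‖ ≤ c * ∑ i, |h i| := by
    refine (norm_sub_norm_le _ _).trans ?_
    rw [← Finset.sum_sub_distrib, Finset.mul_sum]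
    refine (norm_sum_le _ _).trans (Finset.sum_le_sum fun i _ => ?_)
    rw [← smul_sub, norm_smul, Real.norm_eq_abs, mul_comm, norm_sub_rev]
    gcongr
    exact (hx i).le
  have h3 : 1 / (K * N) * ∑ i, |h i| = 2 * (c * ∑ i, |h i|) := by simp only [c]; ring
  linarith

/-- The prescribed values define a functional on the span; extend it to `F` and represent it by
Riesz. -/
theorem exists_inner_eq_of_linearIndependent [FiniteDimensional ℝ F] {κ : Type*} {v : κ → F}
    (hv : LinearIndependent ℝ v) (r : κ → ℝ) : ∃ d : F, ∀ i, inner ℝ (v i) d = r i := by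
  obtain ⟨f, hf⟩ := LinearMap.exists_extend ((Module.Basis.span hv).constr ℝ r)
  refine ⟨(InnerProductSpace.toDual ℝ F).symm f.toContinuousLinearMap, fun i => ?_⟩
  rw [real_inner_comm, InnerProductSpace.toDual_symm_apply]
  have h1 := LinearMap.congr_fun hf (Module.Basis.span hv i)
  rw [Module.Basis.constr_basis] at h1
  simpa [Module.Basis.span_apply] using h1

end General

end SubfeasibleSQP

/-! ### The quadratic subproblem and the linear systems near a point. -/

namespace SubfeasibleSQP

namespace Problem

variable {n m : ℕ} (P : Problem n m)

theorem phi_le_iff {x : E n} {c : ℝ} : P.phi x ≤ c ↔ 0 ≤ c ∧ ∀ j, P.con j x ≤ c := by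
  simp [phi, Finset.fold_max_le]

theorem phi_nonneg (x : E n) : 0 ≤ P.phi x := (P.phi_le_iff.1 le_rfl).1

theorem con_le_phi (j : Fin m) (x : E n) : P.con j x ≤ P.phi x := (P.phi_le_iff.1 le_rfl).2 j

theorem phi_eq_zero_iff {x : E n} : P.phi x = 0 ↔ ∀ j, P.con j x ≤ 0 := by
  rw [← (P.phi_nonneg x).ge_iff_eq', phi_le_iff]
  simp

theorem continuous_phi (hcon : ∀ j, Continuous (P.con j)) : Continuous P.phi := by
  classical
  unfold phi
  induction (Finset.univ : Finset (Fin m)) using Finset.induction_on with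
  | empty => simpa using continuous_const
  | insert j s hj ih =>
    simp only [Finset.fold_insert hj]
    exact (hcon j).max ih

theorem conBar_nonpos (j : Fin m) (x : E n) : P.conBar j x ≤ 0 := by
  unfold conBar
  split_ifs with h
  · exact h
  · linarith [P.con_le_phi j x]

theorem conBar_eq_con {x : E n} (h : P.phi x = 0) (j : Fin m) : P.conBar j x = P.con j x :=
  if_pos (P.phi_eq_zero_iff.1 h j)

theorem abs_conBar_le (j : Fin m) (x : E n) : |P.conBar j x| ≤ |P.con j x| + P.phi x := by
  have h0 := P.phi_nonneg x
  unfold conBar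
  split_ifs with h
  · linarith
  · exact (abs_sub _ _).trans (by rw [abs_of_nonneg h0])

/-- `conBar j` can jump only where `con j` vanishes, and there `j` is active. Off the active set it
is given locally by one of its two continuous branches. -/
theorem eventually_conBar_le (hcon : ∀ j, Continuous (P.con j)) {x₀ : E n} {j : Fin m}
    (hj : j ∉ P.active x₀) : ∃ c > 0, ∀ᶠ x in 𝓝 x₀, P.conBar j x ≤ -c := by
  have hlt : P.conBar j x₀ < 0 := lt_of_le_of_ne (P.conBar_nonpos j x₀) hj
  refine ⟨-P.conBar j x₀ / 2, by linarith, ?_⟩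
  by_cases h : P.con j x₀ ≤ 0
  · have he : P.conBar j x₀ = P.con j x₀ := if_pos h
    rw [he] at hlt ⊢
    filter_upwards [(hcon j).continuousAt.eventually (gt_mem_nhds (show P.con j x₀ <
      P.con j x₀ / 2 by linarith))] with x hx
    rw [conBar, if_pos (by linarith)]
    linarith
  · have he : P.conBar j x₀ = P.con j x₀ - P.phi x₀ := if_neg h
    rw [he] at hlt ⊢
    have hc : Continuous fun x => P.con j x - P.phi x := (hcon j).sub (P.continuous_phi hcon)
    filter_upwards [(hcon j).continuousAt.eventually (lt_mem_nhds (not_le.1 h)),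
      hc.continuousAt.eventually (gt_mem_nhds (show P.con j x₀ - P.phi x₀ <
        (P.con j x₀ - P.phi x₀) / 2 by linarith))] with x hx hx'
    rw [conBar, if_neg (not_le.2 hx)]
    linarith

/-- Near any point some direction is uniformly strictly feasible for the quadratic subproblem. -/
theorem exists_slater_direction (hcon : ∀ j, ContDiff ℝ 2 (P.con j))
    (hind : P.GradientsIndependent) (x₀ : E n) :
    ∃ e : E n, ∃ c > 0, ∀ᶠ x in 𝓝 x₀, ∀ j, P.conBar j x + inner ℝ (P.g j x) e ≤ -c := by
  obtain ⟨e, he⟩ := exists_inner_eq_of_linearIndependent (hind x₀) (fun _ => -1)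
  have hg : ∀ j, Continuous (P.g j) := fun j => continuous_gradient (hcon j)
  -- A small multiple of `e` works: for active `j` the slope `-1` helps and `conBar ≤ 0` suffices,
  -- without continuity; for inactive `j` the slack `c` outweighs `s` times the slope.
  have key : ∀ j, ∀ᶠ s in 𝓝[>] (0 : ℝ), ∃ c₀ > 0, ∀ᶠ x in 𝓝 x₀,
      P.conBar j x + inner ℝ (P.g j x) (s • e) ≤ -c₀ := by
    intro j
    have hin : ContinuousAt (fun x => inner ℝ (P.g j x) e) x₀ :=
      ((hg j).inner continuous_const).continuousAt
    by_cases hj : j ∈ P.active x₀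
    · filter_upwards [self_mem_nhdsWithin] with s hs
      have hs : 0 < s := hs
      refine ⟨s / 2, by positivity, ?_⟩
      have h1 : inner ℝ (P.g j x₀) e = -1 := he ⟨j, hj⟩
      filter_upwards [hin.eventually (gt_mem_nhds (show inner ℝ (P.g j x₀) e < -(1 / 2) by
        rw [h1]; norm_num))] with x hx
      rw [inner_smul_right]
      nlinarith [P.conBar_nonpos j x]
    · obtain ⟨c, hc, hev⟩ := P.eventually_conBar_le (fun j => (hcon j).continuous) hj
      set b := |inner ℝ (P.g j x₀) e| + 1
      have hb : 0 < b := by positivity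
      filter_upwards [self_mem_nhdsWithin, mem_nhdsWithin_of_mem_nhds
        (gt_mem_nhds (show (0 : ℝ) < c / (2 * b) by positivity))] with s hs hs'
      have hs : 0 < s := hs
      rw [lt_div_iff₀ (by positivity)] at hs'
      refine ⟨c / 2, by positivity, ?_⟩
      filter_upwards [hev, hin.eventually (gt_mem_nhds (show inner ℝ (P.g j x₀) e < b from
        lt_of_le_of_lt (le_abs_self _) (lt_add_one _)))] with x hx hx'
      rw [inner_smul_right]
      nlinarith
  obtain ⟨s, hs⟩ := (eventually_all.2 key).exists
  choose c hc hev using hs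
  have hsmall : ∀ᶠ c' in 𝓝[>] (0 : ℝ), 0 < c' ∧ ∀ j, c' < c j :=
    (eventually_mem_nhdsWithin).and
      (eventually_all.2 fun j => mem_nhdsWithin_of_mem_nhds (gt_mem_nhds (hc j)))
  obtain ⟨c', hc', hlt⟩ := hsmall.exists
  refine ⟨s • e, c', hc', ?_⟩
  filter_upwards [eventually_all.2 hev] with x hx j
  linarith [hx j, hlt j]

/-- Multipliers of the quadratic subproblem are locally bounded. -/
theorem exists_multiplier_bound (hobj : ContDiff ℝ 2 P.obj) (hcon : ∀ j, ContDiff ℝ 2 (P.con j))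
    (hind : P.GradientsIndependent) (x₀ : E n) :
    ∃ C, 0 ≤ C ∧ ∀ᶠ x in 𝓝 x₀, ∀ (v d₀ : E n) (lam : Fin m → ℝ),
      P.g₀ x + v + ∑ j, lam j • P.g j x = 0 → (∀ j, 0 ≤ lam j) →
      (∀ j, lam j * (P.conBar j x + inner ℝ (P.g j x) d₀) = 0) →
      ∑ j, lam j ≤ C * ((1 + ‖v‖) * (1 + ‖d₀‖)) := by
  obtain ⟨e, c, hc, hev⟩ := P.exists_slater_direction hcon hind x₀
  have hg₀ : Continuous P.g₀ := continuous_gradient hobj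
  refine ⟨(‖P.g₀ x₀‖ + 2) * (1 + ‖e‖) / c, by positivity, ?_⟩
  filter_upwards [hev, hg₀.norm.continuousAt.eventually (gt_mem_nhds (lt_add_one ‖P.g₀ x₀‖))]
    with x hx hgx v d₀ lam hst hnn hcomp
  have hneg : ∀ u : E n, ∑ j, lam j * inner ℝ (P.g j x) u = -inner ℝ (P.g₀ x + v) u := by
    intro u
    have := congrArg (fun w => inner ℝ w u) hst
    simp only [inner_add_left, sum_inner, real_inner_smul_left, inner_zero_left] at this
    rw [inner_add_left]
    linarith
  have h1 : ∑ j, lam j * P.conBar j x = inner ℝ (P.g₀ x + v) d₀ := by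
    have := hneg d₀
    have h2 : ∑ j, lam j * (P.conBar j x + inner ℝ (P.g j x) d₀) = 0 :=
      Finset.sum_eq_zero fun j _ => hcomp j
    simp only [mul_add, Finset.sum_add_distrib] at h2
    linarith
  have h2 : ∑ j, lam j * (P.conBar j x + inner ℝ (P.g j x) e) ≤ ∑ j, lam j * (-c) :=
    Finset.sum_le_sum fun j _ => mul_le_mul_of_nonneg_left (hx j) (hnn j)
  simp only [mul_add, Finset.sum_add_distrib, h1, hneg e, ← Finset.sum_mul] at h2
  -- Stationarity is tested against `e` and against `d₀`; complementarity turns the latter into the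
  -- value of `∑ lam j * conBar j`.
  have h3 : c * ∑ j, lam j ≤ inner ℝ (P.g₀ x + v) (e - d₀) := by
    rw [inner_sub_right]; linarith
  have h4 : inner ℝ (P.g₀ x + v) (e - d₀) ≤ (‖P.g₀ x‖ + ‖v‖) * (‖e‖ + ‖d₀‖) :=
    (real_inner_le_norm _ _).trans (by gcongr <;> [exact norm_add_le _ _; exact norm_sub_le _ _])
  have h5 : (‖P.g₀ x‖ + ‖v‖) * (‖e‖ + ‖d₀‖) ≤
      ((‖P.g₀ x₀‖ + 2) * (1 + ‖v‖)) * ((1 + ‖e‖) * (1 + ‖d₀‖)) := by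
    have ha := norm_nonneg (P.g₀ x₀)
    have hb := norm_nonneg v
    have hc := norm_nonneg e
    have hd := norm_nonneg d₀
    gcongr
    · nlinarith
    · nlinarith
  rw [div_mul_eq_mul_div, le_div_iff₀ hc]
  calc _ = c * ∑ j, lam j := by ring
    _ ≤ _ := h3.trans (h4.trans h5)
    _ = _ := by ring

theorem diagD_nonneg (x d₀ : E n) (j : Fin m) : 0 ≤ P.diagD x d₀ j := by
  unfold diagD; positivity

/-- Split `conBar` as `(conBar + gᵀd₀) - gᵀd₀`. This keeps the diagonal entries of inactive
constraints away from zero, whatever `d₀` is. -/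
theorem sq_conBar_le_diagD {x : E n} {j : Fin m} {G : ℝ} (hG : ‖P.g j x‖ ≤ G) (d₀ : E n) :
    P.conBar j x ^ 2 ≤ (1 + G) * P.diagD x d₀ j := by
  have hG0 : 0 ≤ G := (norm_nonneg _).trans hG
  have h1 : |P.conBar j x| ≤ (1 + G) * (|P.conBar j x + inner ℝ (P.g j x) d₀| + ‖d₀‖) := by
    have h2 : |P.conBar j x| ≤ |P.conBar j x + inner ℝ (P.g j x) d₀| + |inner ℝ (P.g j x) d₀| := by
      simpa using abs_sub (P.conBar j x + inner ℝ (P.g j x) d₀) (inner ℝ (P.g j x) d₀)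
    have h3 : |inner ℝ (P.g j x) d₀| ≤ G * ‖d₀‖ :=
      (abs_real_inner_le_norm _ _).trans (by gcongr)
    nlinarith [abs_nonneg (P.conBar j x + inner ℝ (P.g j x) d₀), norm_nonneg d₀]
  rw [← sq_abs, sq, diagD]
  nlinarith [abs_nonneg (P.conBar j x)]

set_option maxHeartbeats 800000 in
/-- The solutions of the linear systems are locally bounded by the right-hand side, uniformly in
the matrix and in the diagonal entries. -/
theorem exists_sle_bound_local (hcon : ∀ j, ContDiff ℝ 2 (P.con j))
    (hind : P.GradientsIndependent) {a b : ℝ} (ha : 0 < a) (hb : 0 < b) (x₀ : E n) :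
    ∃ C, ∀ᶠ x in 𝓝 x₀, ∀ (B : Matrix (Fin n) (Fin n) ℝ) (d₀ : E n) (r : Fin m → ℝ) (d : E n)
      (h : Fin m → ℝ) (c : ℝ), a * ‖d‖ ^ 2 ≤ inner ℝ d (B.toEuclideanLin d) →
      ‖B.toEuclideanLin d‖ ≤ b * ‖d‖ → 0 ≤ c → (∀ j, |r j| ≤ c) → P.SolvesSLE B x d₀ r d h →
      ‖d‖ ≤ C * c ∧ ∀ j, |h j| ≤ C * c := by
  classical
  have hg : ∀ j, Continuous (P.g j) := fun j => continuous_gradient (hcon j)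
  set A := P.active x₀
  obtain ⟨c₁, hc₁, hev₁⟩ := eventually_le_norm_sum_smul (v := P.g) (x₀ := x₀)
    (fun j => (hg j).continuousAt) A (hind x₀)
  have hev₂ : ∀ᶠ c₂ in 𝓝[>] (0 : ℝ), 0 < c₂ ∧ ∀ j, ∀ᶠ x in 𝓝 x₀, j ∉ A → P.conBar j x ≤ -c₂ := by
    refine eventually_mem_nhdsWithin.and (eventually_all.2 fun j => ?_)
    by_cases hj : j ∈ A
    · simp [hj]
    · obtain ⟨c, hc, hev⟩ := P.eventually_conBar_le (fun j => (hcon j).continuous) hj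
      filter_upwards [mem_nhdsWithin_of_mem_nhds (gt_mem_nhds hc)] with c' hc'
      filter_upwards [hev] with x hx _
      have : c' < c := hc'
      linarith
  obtain ⟨c₂, hc₂, hev₂⟩ := hev₂.exists
  set G := ∑ j, ‖P.g j x₀‖ + 1
  have hG : 0 < G := by positivity
  have hev₃ : ∀ᶠ x in 𝓝 x₀, ∀ j, ‖P.g j x‖ ≤ G := by
    refine eventually_all.2 fun j => ?_
    have hlt : ‖P.g j x₀‖ < G := by
      have := Finset.single_le_sum (f := fun j => ‖P.g j x₀‖) (fun i _ => norm_nonneg _)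
        (Finset.mem_univ j)
      simp only [G]
      linarith
    filter_upwards [(hg j).norm.continuousAt.eventually (gt_mem_nhds hlt)] with x hx using hx.le
  set c₃ := c₂ ^ 2 / (1 + G) with hc₃def
  have hc₃ : 0 < c₃ := by positivity
  -- `K` comes from squaring `hHle` with `(u + v)² ≤ 2u² + 2v²`. The final constant covers `K` for
  -- `h` and `1 + K / a ≥ √(K / a)` for `d`.
  set K := 2 * (b / c₁) ^ 2 / a + 2 * (G / c₁ + 1) ^ 2 * (m / c₃)
  have hK : 0 ≤ K := by positivity
  refine ⟨K + 1 + K / a, ?_⟩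
  filter_upwards [hev₁, eventually_all.2 hev₂, hev₃] with x hx₁ hx₂ hx₃ B d₀ r d h c hB hB' hc hr hS
  obtain ⟨hS₁, hS₂⟩ := hS
  set H := ∑ j, |h j| with hH
  have hHnn : 0 ≤ H := Finset.sum_nonneg fun j _ => abs_nonneg _
  -- Energy identity: pair the first block row with `d` and substitute the second. Both terms on the
  -- left are nonnegative, so each is at most `H * c`.
  have henergy : inner ℝ d (B.toEuclideanLin d) + ∑ j, P.diagD x d₀ j * h j ^ 2 ≤ H * c := by
    have h1 := congrArg (fun w => inner ℝ d w) hS₁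
    simp only [inner_add_right, inner_sum, real_inner_smul_right, inner_zero_right] at h1
    have h2 : ∀ j, h j * inner ℝ d (P.g j x) = P.diagD x d₀ j * h j ^ 2 + h j * r j := by
      intro j
      rw [← hS₂ j, real_inner_comm]
      ring
    simp only [h2, Finset.sum_add_distrib] at h1
    have h3 : -∑ j, h j * r j ≤ H * c := by
      rw [← Finset.sum_neg_distrib, hH, Finset.sum_mul]
      refine Finset.sum_le_sum fun j _ => ?_
      calc -(h j * r j) ≤ |h j * r j| := neg_le_abs _
        _ = |h j| * |r j| := abs_mul _ _
        _ ≤ |h j| * c := by gcongr; exact hr j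
    linarith
  have hDnn : 0 ≤ ∑ j, P.diagD x d₀ j * h j ^ 2 :=
    Finset.sum_nonneg fun j _ => mul_nonneg (P.diagD_nonneg _ _ _) (sq_nonneg _)
  have hd2 : ‖d‖ ^ 2 ≤ H * c / a := by
    rw [le_div_iff₀ ha]; linarith
  -- Inactive components are controlled by the energy through `D ≥ c₃`, active ones by linear
  -- independence in the first block row.
  set hin : Fin m → ℝ := fun j => if j ∈ A then h j else 0 with hhin
  set hout : Fin m → ℝ := fun j => if j ∈ A then 0 else h j with hhout
  have hsplit : ∀ j, h j = hin j + hout j := by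
    intro j; by_cases hj : j ∈ A <;> simp [hin, hout, hj]
  set H₁ := ∑ j, |hout j| with hH₁
  have hH₁nn : 0 ≤ H₁ := Finset.sum_nonneg fun j _ => abs_nonneg _
  have hH₁sq : H₁ ^ 2 ≤ m / c₃ * (H * c) := by
    have h1 : H₁ ^ 2 ≤ m * ∑ j, |hout j| ^ 2 := by
      have := sq_sum_le_card_mul_sum_sq (s := Finset.univ) (f := fun j => |hout j|)
      simpa using this
    have h2 : c₃ * ∑ j, |hout j| ^ 2 ≤ ∑ j, P.diagD x d₀ j * h j ^ 2 := by
      rw [Finset.mul_sum]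
      refine Finset.sum_le_sum fun j _ => ?_
      by_cases hj : j ∈ A
      · simp only [hout, hj, if_true, abs_zero]
        have := mul_nonneg (P.diagD_nonneg x d₀ j) (sq_nonneg (h j))
        simpa using this
      · simp only [hout, hj, if_false, sq_abs]
        have h3 := P.sq_conBar_le_diagD (hx₃ j) d₀
        have h4 := hx₂ j hj
        have h5 : c₃ ≤ P.diagD x d₀ j := by
          rw [hc₃def, div_le_iff₀ (by positivity)]
          nlinarith
        gcongr
    have h3 : ∑ j, |hout j| ^ 2 ≤ H * c / c₃ := by
      rw [le_div_iff₀ hc₃]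
      nlinarith [mul_nonneg ha.le (sq_nonneg ‖d‖)]
    calc H₁ ^ 2 ≤ m * (H * c / c₃) := h1.trans (by gcongr)
      _ = _ := by ring
  have hin_le : ∑ j, |hin j| ≤ b / c₁ * ‖d‖ + G / c₁ * H₁ := by
    have h1 := hx₁ hin (fun j hj => by simp [hin, hj])
    have h2 : ∑ j, hin j • P.g j x = -(B.toEuclideanLin d) - ∑ j, hout j • P.g j x := by
      simp only [hsplit, add_smul, Finset.sum_add_distrib] at hS₁
      rw [eq_sub_iff_add_eq, eq_neg_iff_add_eq_zero, ← hS₁]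
      abel
    have h3 : ‖∑ j, hout j • P.g j x‖ ≤ G * H₁ := by
      rw [hH₁, Finset.mul_sum]
      refine (norm_sum_le _ _).trans (Finset.sum_le_sum fun j _ => ?_)
      rw [norm_smul, Real.norm_eq_abs, mul_comm]
      gcongr
      exact hx₃ j
    have h4 : ‖∑ j, hin j • P.g j x‖ ≤ b * ‖d‖ + G * H₁ := by
      rw [h2]
      refine (norm_sub_le _ _).trans ?_
      rw [norm_neg]
      linarith
    have h5 : ∑ j, |hin j| ≤ (b * ‖d‖ + G * H₁) / c₁ := by
      rw [le_div_iff₀ hc₁]; linarith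
    calc _ ≤ _ := h5
      _ = _ := by ring
  have hHle : H ≤ b / c₁ * ‖d‖ + (G / c₁ + 1) * H₁ := by
    have h1 : H ≤ ∑ j, |hin j| + H₁ := by
      rw [hH, hH₁, ← Finset.sum_add_distrib]
      refine Finset.sum_le_sum fun j _ => ?_
      rw [hsplit j]
      exact abs_add_le _ _
    linarith
  -- The estimate closes on itself: dividing by `H` bounds `H` by `K * c`.
  have hHsq : H ^ 2 ≤ K * (H * c) := by
    calc H ^ 2 ≤ (b / c₁ * ‖d‖ + (G / c₁ + 1) * H₁) ^ 2 := by gcongr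
      _ ≤ 2 * (b / c₁) ^ 2 * ‖d‖ ^ 2 + 2 * (G / c₁ + 1) ^ 2 * H₁ ^ 2 := by
        nlinarith [sq_nonneg (b / c₁ * ‖d‖ - (G / c₁ + 1) * H₁)]
      _ ≤ 2 * (b / c₁) ^ 2 * (H * c / a) + 2 * (G / c₁ + 1) ^ 2 * (m / c₃ * (H * c)) := by
        gcongr
      _ = K * (H * c) := by simp only [K]; ring
  have hHK : H ≤ K * c := by
    rcases hHnn.eq_or_lt with h0 | h0
    · rw [← h0]; positivity
    · by_contra hcon
      nlinarith
  constructor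
  · have h1 : ‖d‖ ^ 2 ≤ K / a * c ^ 2 := by
      calc ‖d‖ ^ 2 ≤ H * c / a := hd2
        _ ≤ K * c * c / a := by gcongr
        _ = _ := by ring
    have h2 : ‖d‖ ^ 2 ≤ ((1 + K / a) * c) ^ 2 := by
      have : 0 ≤ K / a := by positivity
      rw [mul_pow]
      refine h1.trans ?_
      gcongr
      nlinarith
    have h3 : ‖d‖ ≤ (1 + K / a) * c := le_of_sq_le_sq h2 (by positivity)
    refine h3.trans ?_
    gcongr
    linarith
  · intro j
    have h1 : |h j| ≤ H := Finset.single_le_sum (f := fun j => |h j|) (fun i _ => abs_nonneg _)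
      (Finset.mem_univ j)
    refine (h1.trans hHK).trans ?_
    have : 0 ≤ K / a := by positivity
    gcongr
    linarith

/-- The solutions of the linear systems are bounded by the right-hand side, uniformly on compact
sets. -/
theorem exists_sle_bound (hcon : ∀ j, ContDiff ℝ 2 (P.con j))
    (hind : P.GradientsIndependent) {a b : ℝ} (ha : 0 < a) (hb : 0 < b) {K : Set (E n)}
    (hK : IsCompact K) :
    ∃ C, 0 < C ∧ ∀ x ∈ K, ∀ (B : Matrix (Fin n) (Fin n) ℝ) (d₀ : E n) (r : Fin m → ℝ) (d : E n)
      (h : Fin m → ℝ) (c : ℝ), a * ‖d‖ ^ 2 ≤ inner ℝ d (B.toEuclideanLin d) →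
      ‖B.toEuclideanLin d‖ ≤ b * ‖d‖ → 0 ≤ c → (∀ j, |r j| ≤ c) → P.SolvesSLE B x d₀ r d h →
      ‖d‖ ≤ C * c ∧ ∀ j, |h j| ≤ C * c := by
  have hmono : ∀ (C C' : ℝ) (x : E n), C ≤ C' →
      (∀ (B : Matrix (Fin n) (Fin n) ℝ) (d₀ : E n) (r : Fin m → ℝ) (d : E n)
      (h : Fin m → ℝ) (c : ℝ), a * ‖d‖ ^ 2 ≤ inner ℝ d (B.toEuclideanLin d) →
      ‖B.toEuclideanLin d‖ ≤ b * ‖d‖ → 0 ≤ c → (∀ j, |r j| ≤ c) → P.SolvesSLE B x d₀ r d h →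
      ‖d‖ ≤ C * c ∧ ∀ j, |h j| ≤ C * c) →
      (∀ (B : Matrix (Fin n) (Fin n) ℝ) (d₀ : E n) (r : Fin m → ℝ) (d : E n)
      (h : Fin m → ℝ) (c : ℝ), a * ‖d‖ ^ 2 ≤ inner ℝ d (B.toEuclideanLin d) →
      ‖B.toEuclideanLin d‖ ≤ b * ‖d‖ → 0 ≤ c → (∀ j, |r j| ≤ c) → P.SolvesSLE B x d₀ r d h →
      ‖d‖ ≤ C' * c ∧ ∀ j, |h j| ≤ C' * c) := by
    intro C C' x hC hx B d₀ r d h c h1 h2 hc h4 h5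
    have hle : C * c ≤ C' * c := by gcongr
    obtain ⟨h6, h7⟩ := hx B d₀ r d h c h1 h2 hc h4 h5
    exact ⟨h6.trans hle, fun j => (h7 j).trans hle⟩
  obtain ⟨C, hC⟩ := exists_uniform_of_local hK _ hmono
    (fun x _ => P.exists_sle_bound_local hcon hind ha hb x)
  exact ⟨max C 1, lt_max_of_lt_right one_pos, fun x hx => hmono _ _ x (le_max_left _ _) (hC x hx)⟩

end Problem

end SubfeasibleSQP

/-! ### The weight `β` and uniform estimates along a bounded run. -/

namespace SubfeasibleSQP

section Beta

/-- Factor out `φ ^ (σ - θ) ≤ V`. Terms in `φ ^ σ` can thus be absorbed by the slack `φ ^ θ` of the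
objective tests. -/
theorem rpow_le_mul_rpow {φ V θ σ : ℝ} (hφ : 0 ≤ φ) (hV : φ ≤ V) (hV1 : 1 ≤ V) (hθ : 0 < θ)
    (hθσ : θ < σ) (hσ : σ < 1) : φ ^ σ ≤ V * φ ^ θ := by
  have h1 : φ ^ σ = φ ^ (σ - θ) * φ ^ θ := by
    rw [← Real.rpow_add_of_nonneg hφ (by linarith) hθ.le, sub_add_cancel]
  rw [h1]
  gcongr
  calc φ ^ (σ - θ) ≤ V ^ (σ - θ) := by gcongr
    _ ≤ V ^ (1 : ℝ) := Real.rpow_le_rpow_of_exponent_le hV1 (by linarith)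
    _ = V := Real.rpow_one V

theorem rpow_le_of_one_le {φ V σ : ℝ} (hφ : 0 ≤ φ) (hV : φ ≤ V) (hV1 : 1 ≤ V) (h0 : 0 < σ)
    (hσ : σ < 1) : φ ^ σ ≤ V :=
  calc φ ^ σ ≤ V ^ σ := by gcongr
    _ ≤ V ^ (1 : ℝ) := Real.rpow_le_rpow_of_exponent_le hV1 hσ.le
    _ = V := Real.rpow_one V

variable {n m : ℕ} (P : Problem n m) (p : Params) {x d₀ dt : E n}

theorem beta_le_one : beta P p x d₀ dt ≤ 1 := by
  unfold beta
  split_ifs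
  · exact min_le_left _ _
  · exact le_rfl

theorem beta_nonneg (h : inner ℝ (P.g₀ x) d₀ ≤ 0) : 0 ≤ beta P p x d₀ dt := by
  unfold beta
  split_ifs with hlt
  · have h1 : 0 ≤ (p.θ - 1) * inner ℝ (P.g₀ x) d₀ :=
      mul_nonneg_of_nonpos_of_nonpos (by linarith [p.θ_lt, p.σ_lt]) h
    have h2 : 0 ≤ P.phi x ^ p.θ := Real.rpow_nonneg (P.phi_nonneg x) _
    exact le_min zero_le_one (div_nonneg (by linarith) (by linarith))
  · exact zero_le_one

theorem beta_combination_le (h : inner ℝ (P.g₀ x) d₀ ≤ 0) :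
    (1 - beta P p x d₀ dt) * inner ℝ (P.g₀ x) d₀ + beta P p x d₀ dt * inner ℝ (P.g₀ x) dt ≤
      p.θ * inner ℝ (P.g₀ x) d₀ + P.phi x ^ p.θ := by
  have hφ : 0 ≤ P.phi x ^ p.θ := Real.rpow_nonneg (P.phi_nonneg x) _
  by_cases hlt : inner ℝ (P.g₀ x) d₀ < inner ℝ (P.g₀ x) dt
  · have h1 : beta P p x d₀ dt ≤ ((p.θ - 1) * inner ℝ (P.g₀ x) d₀ + P.phi x ^ p.θ) /
        (inner ℝ (P.g₀ x) dt - inner ℝ (P.g₀ x) d₀) := by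
      rw [beta, if_pos hlt]
      exact min_le_right _ _
    rw [le_div_iff₀ (by linarith)] at h1
    linarith
  · rw [beta, if_neg hlt]
    nlinarith [p.θ_lt, p.σ_lt, not_lt.1 hlt]

/-- Lower bounds for the weight `β` in terms of `S ≥ w`. -/
theorem le_beta {c C S w V : ℝ} (hc : 0 < c) (hC : 0 < C) (hV : 1 ≤ V) (hw : 0 ≤ w) (hwS : w ≤ S)
    (hSV : S ≤ 2 * V)
    (hN : c * S ^ 2 ≤ (p.θ - 1) * inner ℝ (P.g₀ x) d₀ + P.phi x ^ p.θ)
    (hN' : c * w ≤ (p.θ - 1) * inner ℝ (P.g₀ x) d₀ + P.phi x ^ p.θ)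
    (hden : inner ℝ (P.g₀ x) dt - inner ℝ (P.g₀ x) d₀ ≤ C * S) :
    min (1 / (2 * V)) (c / C) * S ≤ beta P p x d₀ dt ∧
      min (1 / (2 * V)) (c / C) * w ≤ beta P p x d₀ dt * S := by
  -- The first entry ensures `k * S ≤ 1`, which serves when `β = 1`; the second ensures `k * C ≤ c`,
  -- which serves when `β` is the quotient.
  set k := min (1 / (2 * V)) (c / C) with hk
  have hk0 : 0 < k := lt_min (by positivity) (by positivity)
  have hk1 : k ≤ 1 / (2 * V) := min_le_left _ _
  have hk2 : k ≤ c / C := min_le_right _ _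
  have hS : 0 ≤ S := hw.trans hwS
  rw [le_div_iff₀ (by positivity)] at hk1
  rw [le_div_iff₀ hC] at hk2
  have hkS : k * S ≤ 1 := by nlinarith
  have hkw : k * w ≤ 1 * S := by nlinarith
  by_cases hlt : inner ℝ (P.g₀ x) d₀ < inner ℝ (P.g₀ x) dt
  · rw [beta, if_pos hlt]
    set N := (p.θ - 1) * inner ℝ (P.g₀ x) d₀ + P.phi x ^ p.θ
    set D := inner ℝ (P.g₀ x) dt - inner ℝ (P.g₀ x) d₀
    have hD : 0 < D := by simp only [D]; linarith
    have hSpos : 0 < S := by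
      by_contra hcon
      nlinarith
    rw [min_mul_of_nonneg 1 _ hS]
    refine ⟨le_min hkS ?_, le_min hkw ?_⟩
    · rw [le_div_iff₀ hD]
      calc k * S * D ≤ k * S * (C * S) := by gcongr
        _ = k * C * S ^ 2 := by ring
        _ ≤ c * S ^ 2 := by gcongr
        _ ≤ N := hN
    · rw [div_mul_eq_mul_div, le_div_iff₀ hD]
      calc k * w * D ≤ k * w * (C * S) := by gcongr
        _ = k * C * w * S := by ring
        _ ≤ c * w * S := by gcongr
        _ ≤ N * S := by gcongr
  · rw [beta, if_neg hlt]
    exact ⟨hkS, hkw⟩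

end Beta

variable {n m : ℕ} {P : Problem n m} {p : Params} {s : Sequences n m}

/-- The quantity `‖d₀‖ + φ^σ` driving the second linear system. -/
noncomputable def magnitude (P : Problem n m) (p : Params) (s : Sequences n m) (k : ℕ) : ℝ :=
  ‖s.d₀ k‖ + P.phi (s.x k) ^ p.σ

/-- The weight `β` at iteration `k`. -/
noncomputable def weight (P : Problem n m) (p : Params) (s : Sequences n m) (k : ℕ) : ℝ :=
  beta P p (s.x k) (s.d₀ k) (s.dt k)

/-- Uniform estimates along a bounded run. -/
structure RunBounds (P : Problem n m) (p : Params) (s : Sequences n m) (a C M V : ℝ) : Prop where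
  a_pos : 0 < a
  C_pos : 0 < C
  M_pos : 0 < M
  one_le_V : 1 ≤ V
  descent : ∀ k, inner ℝ (P.g₀ (s.x k)) (s.d₀ k) ≤ -(a * ‖s.d₀ k‖ ^ 2)
  norm_g₀_le : ∀ k, ‖P.g₀ (s.x k)‖ ≤ V
  phi_le : ∀ k, P.phi (s.x k) ≤ V
  norm_d₀_le : ∀ k, ‖s.d₀ k‖ ≤ V
  norm_d₁_le : ∀ k, ‖s.d₁ k‖ ≤
    C * (‖s.d₀ k‖ ^ p.τ + P.phi (s.x k) ^ p.σ + M * ‖s.d₀ k‖ ^ 2)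
  norm_dt_le : ∀ k, ‖s.dt k‖ ≤ C * magnitude P p s k
  diag_le : ∀ k j, P.diagD (s.x k) (s.d₀ k) j * s.ht k j ≤ |P.conBar j (s.x k)| * V
  taylor_obj : ∀ k, ∀ t, 0 ≤ t → t ≤ 1 → P.obj (s.x k + t • s.q k) ≤
    P.obj (s.x k) + t * inner ℝ (P.g₀ (s.x k)) (s.q k) + M * t ^ 2 * ‖s.q k‖ ^ 2
  taylor_con : ∀ k j, ∀ t, 0 ≤ t → t ≤ 1 → P.con j (s.x k + t • s.q k) ≤
    P.con j (s.x k) + t * inner ℝ (P.g j (s.x k)) (s.q k) + M * t ^ 2 * ‖s.q k‖ ^ 2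

theorem magnitude_nonneg (k : ℕ) : 0 ≤ magnitude P p s k :=
  add_nonneg (norm_nonneg _) (Real.rpow_nonneg (P.phi_nonneg _) _)

theorem norm_combination_le (hs : IsGenerated P p s) {k : ℕ}
    (h : inner ℝ (P.g₀ (s.x k)) (s.d₀ k) ≤ 0) : ‖s.q k‖ ≤ ‖s.d₀ k‖ + ‖s.dt k‖ := by
  have h0 := beta_nonneg P p (dt := s.dt k) h
  have h1 := beta_le_one P p (x := s.x k) (d₀ := s.d₀ k) (dt := s.dt k)
  rw [hs.combination k]
  refine (norm_add_le _ _).trans ?_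
  rw [norm_smul, norm_smul, Real.norm_of_nonneg h0, Real.norm_of_nonneg (by linarith)]
  nlinarith [norm_nonneg (s.d₀ k), norm_nonneg (s.dt k)]

/-- The inner product of the objective gradient with the QP solution. -/
theorem inner_d₀_le (hs : IsGenerated P p s) (k : ℕ) :
    inner ℝ (P.g₀ (s.x k)) (s.d₀ k) ≤ -inner ℝ (s.d₀ k) ((s.B k).toEuclideanLin (s.d₀ k)) := by
  have hm := hs.qp_multiplier k
  have h1 := congrArg (fun w => inner ℝ w (s.d₀ k)) hm.stationary
  simp only [inner_add_left, sum_inner, real_inner_smul_left, inner_zero_left] at h1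
  have h2 : 0 ≤ ∑ j, s.lam k j * inner ℝ (P.g j (s.x k)) (s.d₀ k) := by
    refine Finset.sum_nonneg fun j _ => ?_
    have h3 := hm.complementary j
    have h4 := mul_nonpos_of_nonneg_of_nonpos (hm.nonneg j) (P.conBar_nonpos j (s.x k))
    nlinarith
  rw [real_inner_comm ((s.B k).toEuclideanLin (s.d₀ k))]
  linarith

/-- Bounded runs admit uniform estimates. -/
theorem exists_runBounds (hobj : ContDiff ℝ 2 P.obj) (hcon : ∀ j, ContDiff ℝ 2 (P.con j))
    (hind : P.GradientsIndependent) (hs : IsGenerated P p s) (hB : UniformlyPosDef s.B)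
    (hbdd : Bornology.IsBounded (Set.range s.x)) :
    ∃ a C M V, RunBounds P p s a C M V := by
  obtain ⟨a, b, ha, hb, hab⟩ := hB
  obtain ⟨R, hR⟩ := hbdd.subset_closedBall 0
  have hxR : ∀ k, s.x k ∈ Metric.closedBall (0 : E n) R := fun k => hR ⟨k, rfl⟩
  have hK : IsCompact (Metric.closedBall (0 : E n) R) := isCompact_closedBall _ _
  have hBnorm : ∀ k d, ‖(s.B k).toEuclideanLin d‖ ≤ b * ‖d‖ := fun k d =>
    norm_apply_le_of_form_le (Matrix.isSymmetric_toEuclideanLin_iff.2 (hs.posDef k).isHermitian)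
      (fun d => le_trans (by positivity) (hab k d).1) (fun d => (hab k d).2) d
  have hdesc : ∀ k, inner ℝ (P.g₀ (s.x k)) (s.d₀ k) ≤ -(a * ‖s.d₀ k‖ ^ 2) := fun k => by
    linarith [inner_d₀_le hs k, (hab k (s.d₀ k)).1]
  have hdesc0 : ∀ k, inner ℝ (P.g₀ (s.x k)) (s.d₀ k) ≤ 0 := fun k =>
    (hdesc k).trans (by simp only [Left.neg_nonpos_iff]; positivity)
  have hσ : 0 < p.σ := p.θ_pos.trans p.θ_lt
  have hcc : ∀ j, Continuous (P.con j) := fun j => (hcon j).continuous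
  obtain ⟨G, hG⟩ := hK.exists_bound_of_continuousOn (f := P.g₀)
    (continuous_gradient hobj).continuousOn
  have hGj : ∀ j, ∃ G, ∀ x ∈ Metric.closedBall (0 : E n) R, ‖P.g j x‖ ≤ G := fun j =>
    hK.exists_bound_of_continuousOn (f := P.g j) (continuous_gradient (hcon j)).continuousOn
  choose Gj hGj using hGj
  have hcj : ∀ j, ∃ G, ∀ x ∈ Metric.closedBall (0 : E n) R, ‖|P.con j x| + P.phi x‖ ≤ G :=
    fun j => hK.exists_bound_of_continuousOn
      ((hcc j).abs.add (P.continuous_phi hcc)).continuousOn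
  choose Fj hFj using hcj
  obtain ⟨Φ, hΦ⟩ := hK.exists_bound_of_continuousOn (f := P.phi)
    (P.continuous_phi hcc).continuousOn
  obtain ⟨C, hC, hsle⟩ := P.exists_sle_bound hcon hind ha hb hK
  have hG0 : 0 ≤ G := (norm_nonneg _).trans (hG _ (hxR 0))
  have hΦ0 : 0 ≤ Φ := (norm_nonneg _).trans (hΦ _ (hxR 0))
  have hphi : ∀ k, P.phi (s.x k) ≤ Φ + 1 := fun k =>
    ((le_abs_self _).trans (hΦ _ (hxR k))).trans (by linarith)
  have hd₀ : ∀ k, ‖s.d₀ k‖ ≤ G / a := by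
    intro k
    have h1 := hdesc k
    have h2 := (abs_le.1 (abs_real_inner_le_norm (P.g₀ (s.x k)) (s.d₀ k))).1
    have h3 : ‖P.g₀ (s.x k)‖ * ‖s.d₀ k‖ ≤ G * ‖s.d₀ k‖ := by gcongr; exact hG _ (hxR k)
    rw [le_div_iff₀ ha]
    by_contra hcon
    have h4 : 0 < ‖s.d₀ k‖ := by
      by_contra h5
      have h6 : ‖s.d₀ k‖ = 0 := le_antisymm (not_lt.1 h5) (norm_nonneg _)
      rw [h6] at hcon
      linarith
    nlinarith
  have hmag : ∀ k, magnitude P p s k ≤ G / a + (Φ + 1) := fun k =>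
    add_le_add (hd₀ k) (rpow_le_of_one_le (P.phi_nonneg _) (hphi k) (by linarith) hσ p.σ_lt)
  set S := G / a + (Φ + 1)
  have hS : 0 ≤ S := by positivity
  have hupd : ∀ k, ‖s.dt k‖ ≤ C * magnitude P p s k ∧
      ∀ j, |s.ht k j| ≤ C * magnitude P p s k := fun k =>
    hsle _ (hxR k) (s.B k) (s.d₀ k) _ _ _ _ (hab k _).1 (hBnorm k _) (magnitude_nonneg k)
      (fun j => by rw [abs_neg]; exact (abs_of_nonneg (magnitude_nonneg (P := P) (p := p) k)).le)
      (hs.updated k)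
  have hq : ∀ k, ‖s.q k‖ ≤ G / a + C * S := fun k =>
    (norm_combination_le hs (hdesc0 k)).trans (add_le_add (hd₀ k) ((hupd k).1.trans
      (by gcongr; exact hmag k)))
  -- Enlarged radius: this ball contains every `x + t • q` with `t ∈ [0, 1]` and every `x + d₀`,
  -- where Taylor bounds are needed.
  set R' := R + (G / a + C * S)
  have hR0 : 0 ≤ R := (norm_nonneg _).trans (by simpa using hxR 0)
  have hball : ∀ k (v : E n), ‖v‖ ≤ G / a + C * S → s.x k + v ∈ Metric.closedBall (0 : E n) R' :=
    fun k v hv => by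
      have h1 : ‖s.x k‖ ≤ R := by simpa using hxR k
      simpa [R'] using (norm_add_le _ _).trans (add_le_add h1 hv)
  have hball0 : ∀ k, s.x k ∈ Metric.closedBall (0 : E n) R' := fun k => by
    simpa using hball k 0 (by rw [norm_zero]; positivity)
  obtain ⟨M₀, hM₀, hT₀⟩ := exists_taylor_bound hobj R'
  have hMj : ∀ j, ∃ M, 0 < M ∧ ∀ x ∈ Metric.closedBall (0 : E n) R',
      ∀ y ∈ Metric.closedBall (0 : E n) R',
      |P.con j y - P.con j x - inner ℝ (gradient (P.con j) x) (y - x)| ≤ M * ‖y - x‖ ^ 2 :=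
    fun j => exists_taylor_bound (hcon j) R'
  choose Mj hMj hTj using hMj
  set M := M₀ + ∑ j, Mj j
  have hsumM : 0 ≤ ∑ j, Mj j := Finset.sum_nonneg fun j _ => (hMj j).le
  have hM : 0 < M := by positivity
  have hMle₀ : M₀ ≤ M := by simp only [M]; linarith
  have hMle : ∀ j, Mj j ≤ M := fun j => by
    have := Finset.single_le_sum (f := Mj) (fun i _ => (hMj i).le) (Finset.mem_univ j)
    simp only [M]; linarith
  have hFj0 : ∀ j, 0 ≤ Fj j := fun j => (norm_nonneg _).trans (hFj j _ (hxR 0))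
  have hGj0 : ∀ j, 0 ≤ Gj j := fun j => (norm_nonneg _).trans (hGj j _ (hxR 0))
  set Q := ∑ j, (Fj j + Gj j * (G / a) + G / a) * (C * S)
  have hQj0 : ∀ j, 0 ≤ (Fj j + Gj j * (G / a) + G / a) * (C * S) := fun j => by
    have := hFj0 j
    have := hGj0 j
    positivity
  have hQ0 : 0 ≤ Q := Finset.sum_nonneg fun j _ => hQj0 j
  have hga : 0 ≤ G / a := by positivity
  have hstep : ∀ k (t : ℝ), 0 ≤ t → t ≤ 1 → ‖t • s.q k‖ ≤ G / a + C * S := fun k t h0 h1 => by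
    rw [norm_smul, Real.norm_of_nonneg h0]
    exact (mul_le_of_le_one_left (norm_nonneg _) h1).trans (hq k)
  refine ⟨a, C, M, 1 + G + Φ + G / a + Q, ha, hC, hM, by linarith, hdesc, ?_, ?_, ?_, ?_,
    fun k => (hupd k).1, ?_, ?_, ?_⟩
  · intro k; linarith [hG _ (hxR k)]
  · intro k; linarith [hphi k]
  · intro k; linarith [hd₀ k]
  · intro k
    have hu : 0 ≤ ‖s.d₀ k‖ ^ p.τ := Real.rpow_nonneg (norm_nonneg _) _
    have hw : 0 ≤ P.phi (s.x k) ^ p.σ := Real.rpow_nonneg (P.phi_nonneg _) _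
    refine (hsle _ (hxR k) (s.B k) (s.d₀ k) _ _ _ _ (hab k _).1 (hBnorm k _) (by positivity)
      (fun j => ?_) (hs.correction k)).1
    have h1 : |P.remainder (s.x k) (s.d₀ k) j| ≤ M * ‖s.d₀ k‖ ^ 2 := by
      have := hTj j _ (hball0 k) _ (hball k (s.d₀ k) ((hd₀ k).trans (by
        have : 0 ≤ C * S := by positivity
        linarith)))
      rw [add_sub_cancel_left] at this
      exact this.trans (by gcongr; exact hMle j)
    refine (abs_sub _ _).trans ?_
    rw [abs_neg, abs_of_nonneg (by positivity)]
    linarith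
  · intro k j
    have h1 := (hupd k).2 j
    have h2 : |s.ht k j| ≤ C * S := h1.trans (by gcongr; exact hmag k)
    have h3 : |P.conBar j (s.x k)| ≤ Fj j :=
      (P.abs_conBar_le j _).trans ((le_abs_self _).trans (hFj j _ (hxR k)))
    have h4 : |inner ℝ (P.g j (s.x k)) (s.d₀ k)| ≤ Gj j * (G / a) :=
      (abs_real_inner_le_norm _ _).trans (by
        have := hGj j _ (hxR k)
        have := hd₀ k
        have := hGj0 j
        gcongr)
    have h5 : |P.conBar j (s.x k) + inner ℝ (P.g j (s.x k)) (s.d₀ k)| + ‖s.d₀ k‖ ≤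
        Fj j + Gj j * (G / a) + G / a :=
      add_le_add ((abs_add_le _ _).trans (add_le_add h3 h4)) (hd₀ k)
    have h6 : (|P.conBar j (s.x k) + inner ℝ (P.g j (s.x k)) (s.d₀ k)| + ‖s.d₀ k‖) * s.ht k j ≤
        1 + G + Φ + G / a + Q := by
      calc _ ≤ (|P.conBar j (s.x k) + inner ℝ (P.g j (s.x k)) (s.d₀ k)| + ‖s.d₀ k‖) *
            |s.ht k j| := by gcongr; exact le_abs_self _
        _ ≤ (Fj j + Gj j * (G / a) + G / a) * (C * S) := by
          have := hGj0 j
          have := hFj0 j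
          gcongr
        _ ≤ Q := Finset.single_le_sum
          (f := fun j => (Fj j + Gj j * (G / a) + G / a) * (C * S)) (fun i _ => hQj0 i)
          (Finset.mem_univ j)
        _ ≤ _ := by linarith
    -- The factor `|conBar|` is kept, so that this term can later be paid for by the slack of the
    -- same constraint.
    rw [Problem.diagD, mul_assoc]
    gcongr
  · intro k t h0 h1
    have := (abs_le.1 (hT₀ _ (hball0 k) _ (hball k (t • s.q k) (hstep k t h0 h1)))).2
    rw [add_sub_cancel_left, inner_smul_right, norm_smul, Real.norm_of_nonneg h0, mul_pow] at this
    have h2 : M₀ * (t ^ 2 * ‖s.q k‖ ^ 2) ≤ M * (t ^ 2 * ‖s.q k‖ ^ 2) := by gcongr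
    simp only [Problem.g₀]
    linarith
  · intro k j t h0 h1
    have := (abs_le.1 (hTj j _ (hball0 k) _ (hball k (t • s.q k) (hstep k t h0 h1)))).2
    rw [add_sub_cancel_left, inner_smul_right, norm_smul, Real.norm_of_nonneg h0, mul_pow] at this
    have h2 : Mj j * (t ^ 2 * ‖s.q k‖ ^ 2) ≤ M * (t ^ 2 * ‖s.q k‖ ^ 2) := by
      gcongr; exact hMle j
    simp only [Problem.g]
    linarith

end SubfeasibleSQP

/-! ### Step lengths bounded away from zero. -/

namespace SubfeasibleSQP

variable {n m : ℕ} {P : Problem n m} {p : Params} {s : Sequences n m}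

namespace RunBounds

variable {a C M V : ℝ}

theorem inner_nonpos (hr : RunBounds P p s a C M V) (k : ℕ) :
    inner ℝ (P.g₀ (s.x k)) (s.d₀ k) ≤ 0 := by
  have := hr.descent k
  have : 0 ≤ a * ‖s.d₀ k‖ ^ 2 := mul_nonneg hr.a_pos.le (sq_nonneg _)
  linarith

theorem magnitude_le (hr : RunBounds P p s a C M V) (k : ℕ) : magnitude P p s k ≤ 2 * V := by
  have h1 := hr.norm_d₀_le k
  have h2 := rpow_le_of_one_le (P.phi_nonneg _) (hr.phi_le k) hr.one_le_V
    (p.θ_pos.trans p.θ_lt) p.σ_lt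
  unfold magnitude
  linarith

/-- The right side is, up to a constant, the margin available in the objective test and in the
numerator of `β`. -/
theorem sq_magnitude_le (hr : RunBounds P p s a C M V) (k : ℕ) :
    magnitude P p s k ^ 2 ≤ 2 * V ^ 2 * (‖s.d₀ k‖ ^ 2 + P.phi (s.x k) ^ p.θ) := by
  have hV := hr.one_le_V
  have h0 : 0 ≤ P.phi (s.x k) ^ p.σ := Real.rpow_nonneg (P.phi_nonneg _) _
  have h1 := rpow_le_of_one_le (P.phi_nonneg _) (hr.phi_le k) hV (p.θ_pos.trans p.θ_lt) p.σ_lt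
  have h2 := rpow_le_mul_rpow (P.phi_nonneg _) (hr.phi_le k) hV p.θ_pos p.θ_lt p.σ_lt
  have h3 : (P.phi (s.x k) ^ p.σ) ^ 2 ≤ V ^ 2 * P.phi (s.x k) ^ p.θ := by
    calc (P.phi (s.x k) ^ p.σ) ^ 2 = P.phi (s.x k) ^ p.σ * P.phi (s.x k) ^ p.σ := sq _
      _ ≤ V * (V * P.phi (s.x k) ^ p.θ) := by gcongr
      _ = _ := by ring
  have h4 : ‖s.d₀ k‖ ^ 2 ≤ V ^ 2 * ‖s.d₀ k‖ ^ 2 :=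
    le_mul_of_one_le_left (sq_nonneg _) (one_le_pow₀ hV)
  unfold magnitude
  nlinarith [sq_nonneg (‖s.d₀ k‖ - P.phi (s.x k) ^ p.σ)]

theorem norm_q_le (hr : RunBounds P p s a C M V) (hs : IsGenerated P p s) (k : ℕ) :
    ‖s.q k‖ ≤ (1 + C) * magnitude P p s k := by
  have h1 := norm_combination_le hs (hr.inner_nonpos k)
  have h2 := hr.norm_dt_le k
  have h3 : ‖s.d₀ k‖ ≤ magnitude P p s k :=
    le_add_of_nonneg_right (Real.rpow_nonneg (P.phi_nonneg _) _)
  linarith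

/-- The numerator of `β` dominates both `S²` and `φ^σ`, and its denominator is `O(S)`. The first
bound makes `tβS` beat the Taylor error `t²S²`; the second guarantees decrease of the violation. -/
theorem exists_weight_ge (hr : RunBounds P p s a C M V) : ∃ c > 0, ∀ k,
    c * magnitude P p s k ≤ weight P p s k ∧
      c * P.phi (s.x k) ^ p.σ ≤ weight P p s k * magnitude P p s k := by
  have hV := hr.one_le_V
  have ha := hr.a_pos
  have hC := hr.C_pos
  have hθ : 0 < 1 - p.θ := by linarith [p.θ_lt, p.σ_lt]
  set c₀ := min ((1 - p.θ) * a) 1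
  have hc₀ : 0 < c₀ := lt_min (by positivity) one_pos
  have hc₀a : c₀ ≤ (1 - p.θ) * a := min_le_left _ _
  have hc₀1 : c₀ ≤ 1 := min_le_right _ _
  set c₁ := c₀ / (2 * V ^ 2) with hc₁
  refine ⟨min (1 / (2 * V)) (c₁ / (V * (C + 1))), by positivity, fun k => ?_⟩
  have hv : 0 ≤ P.phi (s.x k) ^ p.θ := Real.rpow_nonneg (P.phi_nonneg _) _
  have hw : 0 ≤ P.phi (s.x k) ^ p.σ := Real.rpow_nonneg (P.phi_nonneg _) _
  have hN : c₀ * (‖s.d₀ k‖ ^ 2 + P.phi (s.x k) ^ p.θ) ≤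
      (p.θ - 1) * inner ℝ (P.g₀ (s.x k)) (s.d₀ k) + P.phi (s.x k) ^ p.θ := by
    have h1 := mul_le_mul_of_nonneg_left (hr.descent k) hθ.le
    have h2 := mul_le_mul_of_nonneg_right hc₀a (sq_nonneg ‖s.d₀ k‖)
    have h3 := mul_le_mul_of_nonneg_right hc₀1 hv
    linarith
  refine le_beta P p (by positivity) (by positivity) hV hw
    (le_add_of_nonneg_left (norm_nonneg _)) (hr.magnitude_le k) (le_trans ?_ hN) (le_trans ?_ hN) ?_
  · rw [hc₁, div_mul_eq_mul_div, div_le_iff₀ (by positivity)]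
    have := mul_le_mul_of_nonneg_left (hr.sq_magnitude_le k) hc₀.le
    linarith
  · have h2 := rpow_le_mul_rpow (P.phi_nonneg _) (hr.phi_le k) hV p.θ_pos p.θ_lt p.σ_lt
    rw [hc₁, div_mul_eq_mul_div, div_le_iff₀ (by positivity), mul_assoc]
    gcongr
    have h3 : V * P.phi (s.x k) ^ p.θ ≤ V ^ 2 * P.phi (s.x k) ^ p.θ := by
      gcongr; nlinarith
    have h4 : 0 ≤ V ^ 2 * ‖s.d₀ k‖ ^ 2 := by positivity
    have h5 : 0 ≤ V ^ 2 * P.phi (s.x k) ^ p.θ := by positivity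
    linarith
  · rw [← inner_sub_right]
    refine (real_inner_le_norm _ _).trans ?_
    have h1 : ‖s.dt k - s.d₀ k‖ ≤ (C + 1) * magnitude P p s k := by
      have h2 := hr.norm_dt_le k
      have h3 : ‖s.d₀ k‖ ≤ magnitude P p s k := le_add_of_nonneg_right hw
      have h4 := norm_sub_le (s.dt k) (s.d₀ k)
      linarith
    rw [mul_assoc]
    gcongr
    exact hr.norm_g₀_le k

theorem weight_nonneg (hr : RunBounds P p s a C M V) (k : ℕ) : 0 ≤ weight P p s k :=
  beta_nonneg P p (hr.inner_nonpos k)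

theorem inner_q_le (hr : RunBounds P p s a C M V) (hs : IsGenerated P p s) (k : ℕ) :
    inner ℝ (P.g₀ (s.x k)) (s.q k) ≤
      p.θ * inner ℝ (P.g₀ (s.x k)) (s.d₀ k) + P.phi (s.x k) ^ p.θ := by
  rw [hs.combination k, inner_add_right, inner_smul_right, inner_smul_right]
  exact beta_combination_le P p (hr.inner_nonpos k)

/-- Feasibility of `d₀` bounds its slope by `|conBar|`, and the linear system gives `dt` the slope
`-S` up to `|conBar| * V`; take the convex combination. -/
theorem inner_con_q_le (hr : RunBounds P p s a C M V) (hs : IsGenerated P p s) (k : ℕ)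
    (j : Fin m) : inner ℝ (P.g j (s.x k)) (s.q k) ≤
      (1 + V) * |P.conBar j (s.x k)| - weight P p s k * magnitude P p s k := by
  have h1 := (hs.updated k).2 j
  have h2 := hr.diag_le k j
  have h3 := (hs.qp_solution k).1 j
  have h4 := abs_of_nonpos (P.conBar_nonpos j (s.x k))
  have h5 := hr.weight_nonneg k
  have h6 : weight P p s k ≤ 1 := beta_le_one P p
  have hV := hr.one_le_V
  rw [hs.combination k, inner_add_right, inner_smul_right, inner_smul_right]
  change (1 - weight P p s k) * _ + weight P p s k * _ ≤ _
  have h7 : inner ℝ (P.g j (s.x k)) (s.dt k) ≤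
      |P.conBar j (s.x k)| * V - magnitude P p s k := by
    unfold magnitude; linarith
  have h8 : inner ℝ (P.g j (s.x k)) (s.d₀ k) ≤ |P.conBar j (s.x k)| := by linarith
  have h9 := mul_le_mul_of_nonneg_left h7 h5
  have h10 := mul_le_mul_of_nonneg_left h8 (sub_nonneg.2 h6)
  have h11 : weight P p s k * (|P.conBar j (s.x k)| * V) ≤ |P.conBar j (s.x k)| * V :=
    mul_le_of_le_one_left (by positivity) h6
  have h12 : 0 ≤ weight P p s k * |P.conBar j (s.x k)| := by positivity
  linarith

/-- All sufficiently small steps along `q` are accepted, uniformly along the run. -/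
theorem exists_stepTestII (hr : RunBounds P p s a C M V) (hs : IsGenerated P p s) :
    ∃ tb > 0, ∀ k t, 0 < t → t ≤ tb →
      StepTestII P p (s.x k) (s.d₀ k) (s.q k) (weight P p s k) t := by
  obtain ⟨c, hc, hwt⟩ := hr.exists_weight_ge
  have hV := hr.one_le_V
  have ha := hr.a_pos
  have hC := hr.C_pos
  have hM := hr.M_pos
  have hγ : 0 < 1 - p.γ := sub_pos.2 p.γ_lt
  have hρ : 0 < p.ρ - 1 := sub_pos.2 p.ρ_gt
  have hθ := p.θ_pos
  set N := M * (1 + C) ^ 2 with hN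
  have hNpos : 0 < N := by positivity
  set e := min (p.θ * a) (p.ρ - 1)
  have he : 0 < e := lt_min (by positivity) hρ
  -- The three thresholds make, in order, the slack `|conBar|` pay for its multiple in the slope,
  -- the objective's Taylor error fit its margin, and the constraints' Taylor error fit `(1 -
  -- γ)tβS`.
  refine ⟨min (1 / (1 + V)) (min ((1 - p.γ) * e / (N * (2 * V ^ 2))) ((1 - p.γ) * c / N)),
    by positivity, fun k t ht htb => ?_⟩
  obtain ⟨ht₁, ht₂, ht₃⟩ : t ≤ 1 / (1 + V) ∧ t ≤ (1 - p.γ) * e / (N * (2 * V ^ 2)) ∧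
      t ≤ (1 - p.γ) * c / N := by simpa [le_min_iff] using htb
  rw [le_div_iff₀ (by positivity)] at ht₁ ht₂ ht₃
  have ht1 : t ≤ 1 := by nlinarith
  have hv : 0 ≤ P.phi (s.x k) ^ p.θ := Real.rpow_nonneg (P.phi_nonneg _) _
  have hS := magnitude_nonneg (P := P) (p := p) (s := s) k
  have hq : M * ‖s.q k‖ ^ 2 ≤ N * magnitude P p s k ^ 2 := by
    calc M * ‖s.q k‖ ^ 2 ≤ M * ((1 + C) * magnitude P p s k) ^ 2 := by
          gcongr; exact hr.norm_q_le hs k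
      _ = _ := by rw [hN]; ring
  -- Since `con - conBar` is `0` for satisfied constraints and `φ` for violated ones, this one
  -- inequality yields both constraint tests.
  have hcon : ∀ j, P.con j (s.x k + t • s.q k) ≤ P.con j (s.x k) - P.conBar j (s.x k) -
      p.γ * t * weight P p s k * magnitude P p s k := by
    intro j
    have h1 := hr.taylor_con k j t ht.le ht1
    have h2 := mul_le_mul_of_nonneg_left (hr.inner_con_q_le hs k j) ht.le
    have h3 := abs_of_nonpos (P.conBar_nonpos j (s.x k))
    have h4 : t * ((1 + V) * |P.conBar j (s.x k)|) ≤ |P.conBar j (s.x k)| := by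
      rw [← mul_assoc]
      exact mul_le_of_le_one_left (abs_nonneg _) ht₁
    have h5 : M * t ^ 2 * ‖s.q k‖ ^ 2 ≤
        (1 - p.γ) * t * weight P p s k * magnitude P p s k := by
      calc M * t ^ 2 * ‖s.q k‖ ^ 2 = t ^ 2 * (M * ‖s.q k‖ ^ 2) := by ring
        _ ≤ t ^ 2 * (N * magnitude P p s k ^ 2) := by gcongr
        _ = t * (t * N) * magnitude P p s k ^ 2 := by ring
        _ ≤ t * ((1 - p.γ) * c) * magnitude P p s k ^ 2 := by gcongr
        _ = (1 - p.γ) * t * (c * magnitude P p s k) * magnitude P p s k := by ring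
        _ ≤ _ := by gcongr; exact (hwt k).1
    linarith
  have hdec : 0 ≤ p.γ * t * weight P p s k * magnitude P p s k := by
    have := p.γ_pos
    have := hr.weight_nonneg k
    positivity
  refine ⟨?_, fun j hj => ?_, fun j hj => ?_⟩
  · have h1 := hr.taylor_obj k t ht.le ht1
    have h2 := hr.inner_q_le hs k
    have h3 := hr.descent k
    have h4 : M * t * ‖s.q k‖ ^ 2 ≤
        (1 - p.γ) * (e * ‖s.d₀ k‖ ^ 2 + e * P.phi (s.x k) ^ p.θ) := by
      calc M * t * ‖s.q k‖ ^ 2 = t * (M * ‖s.q k‖ ^ 2) := by ring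
        _ ≤ t * (N * (2 * V ^ 2 * (‖s.d₀ k‖ ^ 2 + P.phi (s.x k) ^ p.θ))) := by
          refine mul_le_mul_of_nonneg_left (hq.trans ?_) ht.le
          gcongr
          exact hr.sq_magnitude_le k
        _ = t * (N * (2 * V ^ 2)) * (‖s.d₀ k‖ ^ 2 + P.phi (s.x k) ^ p.θ) := by ring
        _ ≤ (1 - p.γ) * e * (‖s.d₀ k‖ ^ 2 + P.phi (s.x k) ^ p.θ) := by gcongr
        _ = _ := by ring
    have h5 : e * ‖s.d₀ k‖ ^ 2 ≤ p.θ * a * ‖s.d₀ k‖ ^ 2 := by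
      gcongr; exact min_le_left _ _
    have h6 : e * P.phi (s.x k) ^ p.θ ≤ (p.ρ - 1) * P.phi (s.x k) ^ p.θ := by
      gcongr; exact min_le_right _ _
    -- `ρ > 1` leaves a margin proportional to `φ^θ` beyond what the bound on `g₀ᵀq` uses.
    have h7 : inner ℝ (P.g₀ (s.x k)) (s.q k) ≤
        -(e * ‖s.d₀ k‖ ^ 2 + e * P.phi (s.x k) ^ p.θ) + p.ρ * P.phi (s.x k) ^ p.θ := by
      have := mul_le_mul_of_nonneg_left h3 hθ.le
      linarith
    have h8 : (1 - p.γ) * inner ℝ (P.g₀ (s.x k)) (s.q k) + M * t * ‖s.q k‖ ^ 2 ≤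
        p.ρ * (1 - p.γ) * P.phi (s.x k) ^ p.θ := by
      have := mul_le_mul_of_nonneg_left h7 hγ.le
      linarith
    have h9 := mul_le_mul_of_nonneg_left h8 ht.le
    linarith
  · have h1 := hcon j
    rw [Problem.conBar, if_neg (not_le.2 hj)] at h1
    change _ ≤ _ - p.γ * t * weight P p s k * magnitude P p s k
    linarith
  · have h1 := hcon j
    rw [Problem.conBar, if_pos hj] at h1
    linarith

/-- The step lengths are bounded away from zero. -/
theorem exists_le_t (hr : RunBounds P p s a C M V) (hs : IsGenerated P p s) :
    ∃ tb > 0, ∀ k, tb ≤ s.t k := by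
  obtain ⟨tb, htb, htest⟩ := hr.exists_stepTestII hs
  have hη := p.η_pos
  have hε := p.ε_pos
  refine ⟨min p.ε (min 1 (p.η * tb)), by positivity, fun k => ?_⟩
  rcases hs.search k with ⟨⟨-, i, hi, hε', -⟩, -⟩ | ⟨-, ⟨i, hi, -, hfail⟩, -⟩
  · exact (min_le_left _ _).trans hε'
  · refine (min_le_right _ _).trans ?_
    rcases i with _ | i
    · rw [hi, pow_zero]; exact min_le_left _ _
    · refine (min_le_right _ _).trans ?_
      -- The preceding trial `η ^ i` was rejected, so it exceeds `tb`.
      have h1 : tb < p.η ^ i := by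
        by_contra hcon
        exact hfail i (Nat.lt_succ_self i) (htest k _ (by positivity) (not_lt.1 hcon))
      rw [hi, pow_succ, mul_comm]
      gcongr

end RunBounds

theorem step_le_one (hs : IsGenerated P p s) (k : ℕ) : s.t k ≤ 1 := by
  rcases hs.search k with ⟨⟨-, i, hi, -⟩, -⟩ | ⟨-, ⟨i, hi, -⟩, -⟩
  · rw [hi]; exact pow_le_one₀ (by norm_num) (by norm_num)
  · rw [hi]; exact pow_le_one₀ p.η_pos.le p.η_lt.le

/-! ### Finite feasibility and vanishing directions. -/

namespace RunBounds

variable {a C M V : ℝ}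

theorem exists_phi_succ_le (hr : RunBounds P p s a C M V) (hs : IsGenerated P p s) :
    ∃ c > 0, ∀ k, P.phi (s.x (k + 1)) ≤
      max 0 (P.phi (s.x k) - c * P.phi (s.x k) ^ p.σ) := by
  obtain ⟨tb, htb, ht⟩ := hr.exists_le_t hs
  obtain ⟨c, hc, hwt⟩ := hr.exists_weight_ge
  have hα := p.α_pos
  have hγ := p.γ_pos
  refine ⟨min (p.α * tb) (p.γ * tb * c), by positivity, fun k => ?_⟩
  have hw : 0 ≤ P.phi (s.x k) ^ p.σ := Real.rpow_nonneg (P.phi_nonneg _) _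
  have htk := ht k
  rw [P.phi_le_iff, hs.step k]
  refine ⟨le_max_left _ _, fun j => ?_⟩
  rcases hs.search k with ⟨⟨-, i, -, -, ⟨-, h₁, h₂⟩, -⟩, hd⟩ | ⟨-, ⟨i, -, ⟨-, h₁, h₂⟩, -⟩, hd⟩ <;>
    rw [hd] <;> rcases le_or_gt (P.con j (s.x k)) 0 with hj | hj
  · exact (h₂ j hj).trans (le_max_left _ _)
  · refine ((h₁ j hj).trans ?_).trans (le_max_right _ _)
    refine sub_le_sub_left ?_ _
    calc _ ≤ p.α * s.t k * P.phi (s.x k) ^ p.σ := by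
          gcongr
          exact (min_le_left _ _).trans (by gcongr)
      _ ≤ _ := by
          have : 0 ≤ ‖s.d₀ k‖ ^ p.τ := Real.rpow_nonneg (norm_nonneg _) _
          have : 0 ≤ s.t k := htb.le.trans htk
          gcongr
          linarith
  · exact (h₂ j hj).trans (le_max_left _ _)
  · refine ((h₁ j hj).trans ?_).trans (le_max_right _ _)
    refine sub_le_sub_left ?_ _
    calc _ ≤ p.γ * tb * c * P.phi (s.x k) ^ p.σ := by gcongr; exact min_le_right _ _
      _ = p.γ * tb * (c * P.phi (s.x k) ^ p.σ) := by ring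
      _ ≤ p.γ * s.t k * (weight P p s k * magnitude P p s k) := by
        have : 0 ≤ s.t k := htb.le.trans htk
        refine mul_le_mul (by gcongr) (hwt k).2 (by positivity) (by positivity)
      _ = _ := by rw [← mul_assoc]; rfl

/-- The iterates become feasible after finitely many steps. -/
theorem eventually_feasible (hr : RunBounds P p s a C M V) (hs : IsGenerated P p s) :
    ∀ᶠ k in atTop, P.phi (s.x k) = 0 := by
  obtain ⟨c, hc, hstep⟩ := hr.exists_phi_succ_le hs
  have hσ : 0 < p.σ := p.θ_pos.trans p.θ_lt
  have hzero : ∀ k, P.phi (s.x k) = 0 → P.phi (s.x (k + 1)) = 0 := fun k hk => by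
    have := hstep k
    rw [hk, Real.zero_rpow hσ.ne'] at this
    exact le_antisymm (by simpa using this) (P.phi_nonneg _)
  suffices h : ∃ k, P.phi (s.x k) = 0 by
    obtain ⟨k, hk⟩ := h
    filter_upwards [eventually_ge_atTop k] with i hi
    induction i, hi using Nat.le_induction with
    | base => exact hk
    | succ i _ ih => exact hzero i ih
  by_contra! hne
  have hpos : ∀ k, 0 < P.phi (s.x k) := fun k => lt_of_le_of_ne (P.phi_nonneg _) (hne k).symm
  have hdec : ∀ k, P.phi (s.x (k + 1)) ≤ P.phi (s.x k) - c * P.phi (s.x k) ^ p.σ := fun k => by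
    rcases le_max_iff.1 (hstep k) with h | h
    · exact absurd h (not_le.2 (hpos _))
    · exact h
  -- If the next violation is still positive, then `c * φ ^ σ < φ`; as `σ < 1`, this bounds `φ`
  -- below, and the decrease per step is then at least a fixed amount.
  have hlow : ∀ k, c ^ (1 / (1 - p.σ)) ≤ P.phi (s.x k) := fun k => by
    have h1 : c * P.phi (s.x k) ^ p.σ ≤ P.phi (s.x k) := by linarith [hdec k, hpos (k + 1)]
    have h2 : c ≤ P.phi (s.x k) ^ (1 - p.σ) := by
      rw [Real.rpow_sub (hpos k), Real.rpow_one, le_div_iff₀ (Real.rpow_pos_of_pos (hpos k) _)]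
      exact h1
    have h3 : 0 < 1 - p.σ := sub_pos.2 p.σ_lt
    calc c ^ (1 / (1 - p.σ)) ≤ (P.phi (s.x k) ^ (1 - p.σ)) ^ (1 / (1 - p.σ)) := by gcongr
      _ = P.phi (s.x k) := by
        rw [← Real.rpow_mul (hpos k).le, mul_one_div_cancel h3.ne', Real.rpow_one]
  set L := c ^ (1 / (1 - p.σ)) with hL
  have hLpos : 0 < L := Real.rpow_pos_of_pos hc _
  have hlin : ∀ k : ℕ, P.phi (s.x k) ≤ P.phi (s.x 0) - k * (c * L ^ p.σ) := by
    intro k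
    induction k with
    | zero => simp
    | succ k ih =>
      have h1 : c * L ^ p.σ ≤ c * P.phi (s.x k) ^ p.σ := by gcongr; exact hlow k
      have h2 := hdec k
      push_cast
      linarith
  have hcl : 0 < c * L ^ p.σ := by positivity
  obtain ⟨k, hk⟩ := exists_nat_gt (P.phi (s.x 0) / (c * L ^ p.σ))
  rw [div_lt_iff₀ hcl] at hk
  linarith [hlin k, hpos k]

/-- Once the iterates are feasible, both step tests make the objective drop by a multiple of
`‖d₀‖²`. Objective values are bounded below, so consecutive differences vanish. -/
theorem tendsto_d₀ (hr : RunBounds P p s a C M V) (hs : IsGenerated P p s)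
    (hobj : Continuous P.obj) (hbdd : Bornology.IsBounded (Set.range s.x)) :
    Tendsto s.d₀ atTop (𝓝 0) := by
  obtain ⟨tb, htb, ht⟩ := hr.exists_le_t hs
  have ha := hr.a_pos
  have hα := p.α_pos
  have hγ := p.γ_pos
  have hθ := p.θ_pos
  set c := min (p.α * tb * a) (p.γ * tb * (p.θ * a))
  have hc : 0 < c := by positivity
  obtain ⟨K, hK⟩ := eventually_atTop.1 (hr.eventually_feasible hs)
  have hdec : ∀ k, K ≤ k → P.obj (s.x (k + 1)) ≤ P.obj (s.x k) - c * ‖s.d₀ k‖ ^ 2 := by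
    intro k hk
    have hφ : P.phi (s.x k) ^ p.θ = 0 := by rw [hK k hk, Real.zero_rpow hθ.ne']
    have h3 := hr.descent k
    have htk := ht k
    have ht0 : 0 ≤ s.t k := htb.le.trans htk
    rw [hs.step k]
    rcases hs.search k with ⟨⟨-, i, -, -, ⟨h₁, -⟩, -⟩, hd⟩ | ⟨-, ⟨i, -, ⟨h₁, -⟩, -⟩, hd⟩ <;>
      rw [hd] <;> rw [hφ, mul_zero, add_zero] at h₁ <;> refine h₁.trans ?_
    · have h4 : p.α * s.t k * inner ℝ (P.g₀ (s.x k)) (s.d₀ k) ≤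
          p.α * s.t k * (-(a * ‖s.d₀ k‖ ^ 2)) := by gcongr
      have h5 : c * ‖s.d₀ k‖ ^ 2 ≤ p.α * s.t k * a * ‖s.d₀ k‖ ^ 2 := by
        gcongr; exact (min_le_left _ _).trans (by gcongr)
      linarith
    · have h2 := hr.inner_q_le hs k
      rw [hφ, add_zero] at h2
      have h4 : p.γ * s.t k * inner ℝ (P.g₀ (s.x k)) (s.q k) ≤
          p.γ * s.t k * (p.θ * (-(a * ‖s.d₀ k‖ ^ 2))) := by
        gcongr
        exact h2.trans (by gcongr)
      have h5 : c * ‖s.d₀ k‖ ^ 2 ≤ p.γ * s.t k * (p.θ * a) * ‖s.d₀ k‖ ^ 2 := by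
        gcongr; exact (min_le_right _ _).trans (by gcongr)
      linarith
  have hanti : Antitone fun i => P.obj (s.x (K + i)) := antitone_nat_of_succ_le fun i => by
    have := hdec (K + i) (by omega)
    have : 0 ≤ c * ‖s.d₀ (K + i)‖ ^ 2 := by positivity
    rw [← add_assoc]
    linarith
  have hbelow : BddBelow (Set.range fun i => P.obj (s.x (K + i))) := by
    obtain ⟨R, hR⟩ := hbdd.subset_closedBall 0
    refine ((isCompact_closedBall (0 : E n) R).image hobj).bddBelow.mono ?_
    rintro _ ⟨i, rfl⟩
    exact ⟨_, hR ⟨_, rfl⟩, rfl⟩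
  have hlim := tendsto_atTop_ciInf hanti hbelow
  have hlim' := (tendsto_add_atTop_iff_nat 1).2 hlim
  have hdiff := hlim.sub hlim'
  rw [sub_self] at hdiff
  have hsq : Tendsto (fun i => c * ‖s.d₀ (K + i)‖ ^ 2) atTop (𝓝 0) := by
    refine squeeze_zero (fun i => by positivity) (fun i => ?_) hdiff
    have := hdec (K + i) (by omega)
    rw [← add_assoc]
    linarith
  have hsq' : Tendsto (fun i => ‖s.d₀ (K + i)‖) atTop (𝓝 0) := by
    have h1 := (hsq.const_mul c⁻¹).sqrt
    simpa [← mul_assoc, inv_mul_cancel₀ hc.ne'] using h1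
  have h2 : Tendsto (fun i => ‖s.d₀ i‖) atTop (𝓝 0) := by
    rw [← tendsto_add_atTop_iff_nat K]
    simpa only [add_comm] using hsq'
  exact tendsto_zero_iff_norm_tendsto_zero.2 h2

theorem tendsto_phi (hr : RunBounds P p s a C M V) (hs : IsGenerated P p s) :
    Tendsto (fun k => P.phi (s.x k)) atTop (𝓝 0) :=
  tendsto_const_nhds.congr' ((hr.eventually_feasible hs).mono fun _ h => h.symm)

theorem tendsto_magnitude (hr : RunBounds P p s a C M V) (hs : IsGenerated P p s)
    (hd₀ : Tendsto s.d₀ atTop (𝓝 0)) : Tendsto (magnitude P p s) atTop (𝓝 0) := by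
  have hσ : 0 < p.σ := p.θ_pos.trans p.θ_lt
  have h := hd₀.norm.add ((hr.tendsto_phi hs).rpow_const (p := p.σ) (Or.inr hσ.le))
  rw [norm_zero, Real.zero_rpow hσ.ne', add_zero] at h
  exact h

theorem tendsto_dt (hr : RunBounds P p s a C M V) (hs : IsGenerated P p s)
    (hd₀ : Tendsto s.d₀ atTop (𝓝 0)) : Tendsto s.dt atTop (𝓝 0) :=
  squeeze_zero_norm hr.norm_dt_le (by simpa using (hr.tendsto_magnitude hs hd₀).const_mul C)

theorem tendsto_q (hr : RunBounds P p s a C M V) (hs : IsGenerated P p s)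
    (hd₀ : Tendsto s.d₀ atTop (𝓝 0)) : Tendsto s.q atTop (𝓝 0) :=
  squeeze_zero_norm (hr.norm_q_le hs)
    (by simpa using (hr.tendsto_magnitude hs hd₀).const_mul (1 + C))

theorem tendsto_d₁ (hr : RunBounds P p s a C M V) (hs : IsGenerated P p s)
    (hd₀ : Tendsto s.d₀ atTop (𝓝 0)) : Tendsto s.d₁ atTop (𝓝 0) := by
  have hσ : 0 < p.σ := p.θ_pos.trans p.θ_lt
  have hτ : 0 < p.τ := by linarith [p.τ_gt]
  have h := (((hd₀.norm.rpow_const (p := p.τ) (Or.inr hτ.le)).add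
    ((hr.tendsto_phi hs).rpow_const (p := p.σ) (Or.inr hσ.le))).add
    ((hd₀.norm.pow 2).const_mul M)).const_mul C
  refine squeeze_zero_norm hr.norm_d₁_le ?_
  simpa [Real.zero_rpow hσ.ne', Real.zero_rpow hτ.ne'] using h

theorem tendsto_d (hr : RunBounds P p s a C M V) (hs : IsGenerated P p s)
    (hd₀ : Tendsto s.d₀ atTop (𝓝 0)) : Tendsto s.d atTop (𝓝 0) := by
  have h1 := (hd₀.add (hr.tendsto_d₁ hs hd₀)).norm
  have h2 := (hr.tendsto_q hs hd₀).norm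
  have h3 := h1.add h2
  simp only [add_zero, norm_zero] at h3
  refine squeeze_zero_norm (fun k => ?_) h3
  rcases hs.search k with ⟨-, hd⟩ | ⟨-, -, hd⟩ <;> rw [hd]
  · exact le_add_of_nonneg_right (norm_nonneg _)
  · exact le_add_of_nonneg_left (norm_nonneg _)

theorem tendsto_step (hr : RunBounds P p s a C M V) (hs : IsGenerated P p s)
    (hd₀ : Tendsto s.d₀ atTop (𝓝 0)) :
    Tendsto (fun k => ‖s.x (k + 1) - s.x k‖) atTop (𝓝 0) := by
  obtain ⟨tb, htb, ht⟩ := hr.exists_le_t hs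
  refine squeeze_zero (fun k => norm_nonneg _) (fun k => ?_)
    (tendsto_zero_iff_norm_tendsto_zero.1 (hr.tendsto_d hs hd₀))
  rw [hs.step k, add_sub_cancel_left, norm_smul, Real.norm_of_nonneg (htb.le.trans (ht k))]
  exact mul_le_of_le_one_left (norm_nonneg _) (step_le_one hs k)

end RunBounds

end SubfeasibleSQP

/-! ### KKT points: uniqueness of multipliers, closedness, isolation. -/

namespace SubfeasibleSQP

variable {n m : ℕ}

namespace Problem

variable {P : Problem n m}

theorem IsKKTPair.phi_eq_zero {x : E n} {lam : Fin m → ℝ} (h : P.IsKKTPair x lam) :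
    P.phi x = 0 := P.phi_eq_zero_iff.2 h.feasible

/-- Multipliers are unique under the constraint qualification. -/
theorem IsKKTPair.unique (hcon : ∀ j, ContDiff ℝ 2 (P.con j)) (hind : P.GradientsIndependent)
    {x : E n} {lam lam' : Fin m → ℝ} (h : P.IsKKTPair x lam) (h' : P.IsKKTPair x lam') :
    lam = lam' := by
  obtain ⟨c, hc, hev⟩ := eventually_le_norm_sum_smul (v := P.g) (x₀ := x)
    (fun j => (continuous_gradient (hcon j)).continuousAt) (P.active x) (hind x)
  have h1 := hev.self_of_nhds (fun j => lam j - lam' j) (fun j hj => by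
    have hj' : P.con j x ≠ 0 := by
      rw [← P.conBar_eq_con h.phi_eq_zero j]; exact hj
    have h2 := (mul_eq_zero.1 (h.complementary j)).resolve_right hj'
    have h3 := (mul_eq_zero.1 (h'.complementary j)).resolve_right hj'
    rw [h2, h3, sub_zero])
  have h2 : ∑ j, (lam j - lam' j) • P.g j x = 0 := by
    simp only [sub_smul, Finset.sum_sub_distrib]
    rw [eq_neg_of_add_eq_zero_right h.stationary, eq_neg_of_add_eq_zero_right h'.stationary,
      sub_self]
  rw [h2, norm_zero] at h1
  have h3 : ∑ j, |lam j - lam' j| = 0 :=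
    le_antisymm (by by_contra hcon; nlinarith) (Finset.sum_nonneg fun j _ => abs_nonneg _)
  funext j
  have h4 := (Finset.sum_eq_zero_iff_of_nonneg (fun j _ => abs_nonneg _)).1 h3 j
    (Finset.mem_univ j)
  exact sub_eq_zero.1 (abs_eq_zero.1 h4)

/-- Limits of approximate KKT pairs are KKT pairs. -/
theorem isKKTPair_of_tendsto (hobj : ContDiff ℝ 2 P.obj) (hcon : ∀ j, ContDiff ℝ 2 (P.con j))
    {α : Type*} {l : Filter α} [l.NeBot] {y v d : α → E n} {mu : α → Fin m → ℝ} {x : E n}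
    {lam : Fin m → ℝ} (hy : Tendsto y l (𝓝 x)) (hv : Tendsto v l (𝓝 0)) (hd : Tendsto d l (𝓝 0))
    (hmu : Tendsto mu l (𝓝 lam))
    (hst : ∀ᶠ i in l, P.g₀ (y i) + v i + ∑ j, mu i j • P.g j (y i) = 0)
    (hfeas : ∀ᶠ i in l, ∀ j, P.con j (y i) ≤ 0) (hnn : ∀ᶠ i in l, ∀ j, 0 ≤ mu i j)
    (hcomp : ∀ᶠ i in l, ∀ j, mu i j * (P.con j (y i) + inner ℝ (P.g j (y i)) (d i)) = 0) :
    P.IsKKTPair x lam := by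
  have hg₀ : Tendsto (fun i => P.g₀ (y i)) l (𝓝 (P.g₀ x)) :=
    ((continuous_gradient hobj).tendsto x).comp hy
  have hg : ∀ j, Tendsto (fun i => P.g j (y i)) l (𝓝 (P.g j x)) := fun j =>
    ((continuous_gradient (hcon j)).tendsto x).comp hy
  have hf : ∀ j, Tendsto (fun i => P.con j (y i)) l (𝓝 (P.con j x)) := fun j =>
    ((hcon j).continuous.tendsto x).comp hy
  have hm : ∀ j, Tendsto (fun i => mu i j) l (𝓝 (lam j)) := fun j => (tendsto_pi_nhds.1 hmu) j
  refine ⟨?_, fun j => ?_, fun j => ?_, fun j => ?_⟩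
  · have h1 := (hg₀.add hv).add (tendsto_finsetSum Finset.univ fun j _ => (hm j).smul (hg j))
    rw [add_zero] at h1
    exact tendsto_nhds_unique_of_eventuallyEq h1 tendsto_const_nhds hst
  · exact le_of_tendsto (hf j) (hfeas.mono fun i h => h j)
  · exact ge_of_tendsto (hm j) (hnn.mono fun i h => h j)
  · have h1 := (hm j).mul ((hf j).add ((hg j).inner hd))
    rw [inner_zero_right, add_zero] at h1
    exact tendsto_nhds_unique_of_eventuallyEq h1 tendsto_const_nhds (hcomp.mono fun i h => h j)

theorem mem_closedBall_of_sum_le {lam : Fin m → ℝ} {C : ℝ} (hnn : ∀ j, 0 ≤ lam j)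
    (hsum : ∑ j, lam j ≤ C) : lam ∈ Metric.closedBall (0 : Fin m → ℝ) C := by
  have hC : 0 ≤ C := (Finset.sum_nonneg fun j _ => hnn j).trans hsum
  rw [mem_closedBall_zero_iff, pi_norm_le_iff_of_nonneg hC]
  intro j
  rw [Real.norm_of_nonneg (hnn j)]
  exact (Finset.single_le_sum (f := lam) (fun i _ => hnn i) (Finset.mem_univ j)).trans hsum

theorem fderiv_lagrangian_apply (hobj : ContDiff ℝ 2 P.obj) (hcon : ∀ j, ContDiff ℝ 2 (P.con j))
    (lam : Fin m → ℝ) (x d : E n) : fderiv ℝ (P.lagrangian lam) x d =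
      inner ℝ (P.g₀ x + ∑ j, lam j • P.g j x) d := by
  have h : HasFDerivAt (P.lagrangian lam)
      (fderiv ℝ P.obj x + ∑ j, lam j • fderiv ℝ (P.con j) x) x := by
    have h1 := (hobj.differentiable two_ne_zero x).hasFDerivAt
    have h2 : ∀ j ∈ Finset.univ, HasFDerivAt (fun y => lam j * P.con j y)
        (lam j • fderiv ℝ (P.con j) x) x := fun j _ =>
      (((hcon j).differentiable two_ne_zero x).hasFDerivAt).const_mul (lam j)
    exact h1.add (HasFDerivAt.fun_sum h2)
  rw [h.fderiv]
  simp [inner_add_left, sum_inner, real_inner_smul_left, g₀, g, inner_gradient_left]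

theorem contDiff_lagrangian (hobj : ContDiff ℝ 2 P.obj) (hcon : ∀ j, ContDiff ℝ 2 (P.con j))
    (lam : Fin m → ℝ) : ContDiff ℝ 2 (P.lagrangian lam) :=
  hobj.add (ContDiff.sum fun j _ => contDiff_const.mul (hcon j))

/-- Under the strong second-order condition, a KKT point is isolated among the KKT points. -/
theorem eventually_not_isKKTPair (hobj : ContDiff ℝ 2 P.obj) (hcon : ∀ j, ContDiff ℝ 2 (P.con j))
    (hind : P.GradientsIndependent) {x : E n} {lam : Fin m → ℝ} (hx : P.IsKKTPair x lam)
    (hss : P.SSOSC x lam) : ∀ᶠ y in 𝓝[≠] x, ¬ ∃ mu, P.IsKKTPair y mu := by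
  by_contra hfr
  have hne : (𝓝[≠] x ⊓ 𝓟 {y | ∃ mu, P.IsKKTPair y mu}).NeBot :=
    frequently_mem_iff_neBot.1 hfr
  -- An ultrafilter of KKT points tending to `x` replaces repeated passage to subsequences.
  let U := Ultrafilter.of (𝓝[≠] x ⊓ 𝓟 {y | ∃ mu, P.IsKKTPair y mu})
  have hU : (U : Filter (E n)) ≤ 𝓝[≠] x ⊓ 𝓟 {y | ∃ mu, P.IsKKTPair y mu} := Ultrafilter.of_le _
  have hUx : (U : Filter (E n)) ≤ 𝓝 x := hU.trans (inf_le_left.trans nhdsWithin_le_nhds)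
  have hUne : ∀ᶠ y in (U : Filter (E n)), y ≠ x :=
    (hU.trans inf_le_left) self_mem_nhdsWithin
  have hUk : ∀ᶠ y in (U : Filter (E n)), ∃ mu, P.IsKKTPair y mu :=
    (hU.trans inf_le_right) (mem_principal_self _)
  have hmu : ∃ mu : E n → Fin m → ℝ, ∀ᶠ y in (U : Filter (E n)), P.IsKKTPair y (mu y) := by
    classical
    refine ⟨fun y => if h : ∃ mu, P.IsKKTPair y mu then h.choose else 0, ?_⟩
    filter_upwards [hUk] with y hy
    rw [dif_pos hy]
    exact hy.choose_spec
  obtain ⟨mu, hmu⟩ := hmu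
  have hid : Tendsto (fun y : E n => y) U (𝓝 x) := hUx
  -- the multipliers converge to `lam`
  have hmulim : Tendsto mu U (𝓝 lam) := by
    obtain ⟨C, hC, hbd⟩ := P.exists_multiplier_bound hobj hcon hind x
    have hmem : ∀ᶠ y in (U : Filter (E n)), mu y ∈ Metric.closedBall (0 : Fin m → ℝ) C := by
      filter_upwards [hUx hbd, hmu] with y hy hky
      refine mem_closedBall_of_sum_le hky.nonneg ?_
      have := hy 0 0 (mu y) (by rw [add_zero]; exact hky.stationary) hky.nonneg (fun j => by
        rw [inner_zero_right, add_zero, P.conBar_eq_con hky.phi_eq_zero]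
        exact hky.complementary j)
      simpa using this
    obtain ⟨lam', -, hlam'⟩ := (isCompact_closedBall (0 : Fin m → ℝ) C).ultrafilter_le_nhds
      (U.map mu) (le_principal_iff.2 hmem)
    have hk' : P.IsKKTPair x lam' := isKKTPair_of_tendsto hobj hcon hid
      (tendsto_const_nhds (x := (0 : E n))) (tendsto_const_nhds (x := (0 : E n))) hlam'
      (hmu.mono fun y h => by rw [add_zero]; exact h.stationary)
      (hmu.mono fun y h => h.feasible) (hmu.mono fun y h => h.nonneg)
      (hmu.mono fun y h j => by rw [inner_zero_right, add_zero]; exact h.complementary j)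
    rw [hx.unique hcon hind hk']
    exact hlam'
  -- the normalized directions converge
  let u : E n → E n := fun y => ‖y - x‖⁻¹ • (y - x)
  have hrpos : ∀ᶠ y in (U : Filter (E n)), 0 < ‖y - x‖ :=
    hUne.mono fun y hy => norm_pos_iff.2 (sub_ne_zero.2 hy)
  have hunorm : ∀ᶠ y in (U : Filter (E n)), u y ∈ Metric.sphere (0 : E n) 1 := by
    filter_upwards [hrpos] with y hy
    rw [mem_sphere_zero_iff_norm, norm_smul, norm_inv, norm_norm, inv_mul_cancel₀ hy.ne']
  obtain ⟨d, hd, hud⟩ := (isCompact_sphere (0 : E n) 1).ultrafilter_le_nhds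
    (U.map u) (le_principal_iff.2 hunorm)
  have hud : Tendsto u U (𝓝 d) := hud
  have hd0 : d ≠ 0 := by
    rintro rfl
    simp at hd
  -- If `lam j > 0`, then `mu y j > 0` near `x`, so `con j` vanishes at both `y` and `x` and its
  -- derivative vanishes along the limit direction.
  have hcrit : ∀ j, 0 < lam j → inner ℝ (P.g j x) d = 0 := by
    intro j hj
    have hder : HasFDerivAt (P.con j) (fderiv ℝ (P.con j) x) x :=
      ((hcon j).differentiable two_ne_zero x).hasFDerivAt
    have h1 : Tendsto (fun y => ‖y - x‖⁻¹ * ‖P.con j y - P.con j x - fderiv ℝ (P.con j) x (y - x)‖)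
        U (𝓝 0) := (hasFDerivAt_iff_tendsto.1 hder).mono_left hUx
    have h2 : Tendsto (fun y => ‖inner ℝ (P.g j x) (u y)‖) U (𝓝 0) := by
      refine h1.congr' ?_
      have hpos : ∀ᶠ y in (U : Filter (E n)), 0 < mu y j :=
        ((tendsto_pi_nhds.1 hmulim) j).eventually (lt_mem_nhds hj)
      filter_upwards [hpos, hmu] with y hy hky
      have h3 : P.con j y = 0 := (mul_eq_zero.1 (hky.complementary j)).resolve_left hy.ne'
      have h4 : P.con j x = 0 := (mul_eq_zero.1 (hx.complementary j)).resolve_left hj.ne'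
      rw [h3, h4, sub_zero, zero_sub, norm_neg, inner_smul_right, norm_mul, norm_inv, norm_norm, g,
        inner_gradient_left]
    have h3 : Tendsto (fun y => ‖inner ℝ (P.g j x) (u y)‖) U (𝓝 ‖inner ℝ (P.g j x) d‖) :=
      (tendsto_const_nhds.inner hud).norm
    exact norm_eq_zero.1 (tendsto_nhds_unique h3 h2)
  set F := fderiv ℝ (P.lagrangian lam) with hF
  set H := fderiv ℝ F x with hH
  have hpos : 0 < H d d := hss d hd0 hcrit
  have hFx : F x = 0 := by
    ext v
    rw [hF, fderiv_lagrangian_apply hobj hcon, hx.stationary]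
    simp
  have hFder : HasFDerivAt F H x := by
    have h1 : ContDiff ℝ 1 F :=
      (contDiff_lagrangian hobj hcon lam).fderiv_right (by norm_num)
    exact (h1.differentiable one_ne_zero x).hasFDerivAt
  have hrem : Tendsto (fun y => ‖y - x‖⁻¹ * ‖F y - F x - H (y - x)‖) U (𝓝 0) :=
    (hasFDerivAt_iff_tendsto.1 hFder).mono_left hUx
  have hM : ∀ j, ∃ M, 0 < M ∧ ∀ y ∈ Metric.closedBall (0 : E n) (‖x‖ + 1),
      ∀ z ∈ Metric.closedBall (0 : E n) (‖x‖ + 1),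
      |P.con j z - P.con j y - inner ℝ (gradient (P.con j) y) (z - y)| ≤ M * ‖z - y‖ ^ 2 :=
    fun j => exists_taylor_bound (hcon j) _
  choose M hM hT using hM
  have hnear : ∀ᶠ y in (U : Filter (E n)), y ∈ Metric.closedBall (0 : E n) (‖x‖ + 1) := by
    refine hUx ?_
    filter_upwards [continuous_norm.continuousAt.eventually (gt_mem_nhds (lt_add_one ‖x‖))]
      with y hy
    simpa using hy.le
  -- The right side tends to `0`, so the limit direction has `H d d ≤ 0`, against the second-order
  -- condition.
  have hineq : ∀ᶠ y in (U : Filter (E n)), H (u y) (u y) ≤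
      ‖y - x‖⁻¹ * ‖F y - F x - H (y - x)‖ + ∑ j, |mu y j - lam j| * M j := by
    filter_upwards [hrpos, hmu, hnear] with y hr hky hy
    have hval : F y (y - x) ≤ (∑ j, |mu y j - lam j| * M j) * ‖y - x‖ ^ 2 := by
      have h1 : F y (y - x) = ∑ j, (lam j - mu y j) * inner ℝ (P.g j y) (y - x) := by
        rw [hF, fderiv_lagrangian_apply hobj hcon]
        have h2 := congrArg (fun w => inner ℝ w (y - x)) hky.stationary
        simp only [inner_add_left, sum_inner, real_inner_smul_left, inner_zero_left] at h2
        simp only [inner_add_left, sum_inner, real_inner_smul_left, sub_mul,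
          Finset.sum_sub_distrib]
        linarith
      rw [h1, Finset.sum_mul]
      refine Finset.sum_le_sum fun j _ => ?_
      have h3 := hT j y hy x (by simp)
      rw [← neg_sub y x, inner_neg_right, norm_neg] at h3
      set e := P.con j x - P.con j y - -inner ℝ (gradient (P.con j) y) (y - x) with he
      have h4 : inner ℝ (P.g j y) (y - x) = e + P.con j y - P.con j x := by
        rw [he, g]; ring
      -- By complementarity at both points the product equals `lam j * con j y + mu y j * con j x`.
      have h5 : (lam j - mu y j) * (P.con j y - P.con j x) ≤ 0 := by
        have h6 := hx.complementary j
        have h7 := hky.complementary j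
        have h8 := mul_nonpos_of_nonneg_of_nonpos (hx.nonneg j) (hky.feasible j)
        have h9 := mul_nonpos_of_nonneg_of_nonpos (hky.nonneg j) (hx.feasible j)
        linarith
      have h6 : (lam j - mu y j) * e ≤ |mu y j - lam j| * (M j * ‖y - x‖ ^ 2) := by
        calc (lam j - mu y j) * e ≤ |(lam j - mu y j) * e| := le_abs_self _
          _ = |mu y j - lam j| * |e| := by rw [abs_mul, abs_sub_comm]
          _ ≤ _ := by gcongr
      rw [h4]
      linarith
    have hexp : H (y - x) (y - x) ≤
        ‖F y - F x - H (y - x)‖ * ‖y - x‖ + F y (y - x) := by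
      have h1 := (F y - F x - H (y - x)).le_opNorm (y - x)
      have h2 := (abs_le.1 (Real.norm_eq_abs _ ▸ h1)).1
      rw [hFx] at h2 ⊢
      simp only [_root_.sub_apply, _root_.zero_apply] at h2
      linarith
    have h3 : H (u y) (u y) = (‖y - x‖⁻¹) ^ 2 * H (y - x) (y - x) := by
      simp only [u, map_smul, _root_.smul_apply, smul_eq_mul]
      ring
    rw [h3]
    calc (‖y - x‖⁻¹) ^ 2 * H (y - x) (y - x)
        ≤ (‖y - x‖⁻¹) ^ 2 * (‖F y - F x - H (y - x)‖ * ‖y - x‖ +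
          (∑ j, |mu y j - lam j| * M j) * ‖y - x‖ ^ 2) := by
          gcongr
          linarith
      _ = _ := by field_simp
  have hlim1 : Tendsto (fun y => H (u y) (u y)) U (𝓝 (H d d)) := by
    have hc : Continuous fun v : E n => H v v := H.continuous.clm_apply continuous_id
    exact (hc.tendsto d).comp hud
  have hlim2 : Tendsto (fun y => ‖y - x‖⁻¹ * ‖F y - F x - H (y - x)‖ +
      ∑ j, |mu y j - lam j| * M j) U (𝓝 0) := by
    have h1 : Tendsto (fun y => ∑ j, |mu y j - lam j| * M j) U
        (𝓝 (∑ j, |lam j - lam j| * M j)) :=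
      tendsto_finsetSum _ fun j _ =>
        ((((tendsto_pi_nhds.1 hmulim) j).sub tendsto_const_nhds).abs).mul tendsto_const_nhds
    simpa using hrem.add h1
  exact absurd (le_of_tendsto_of_tendsto hlim1 hlim2 hineq) (not_le.2 hpos)

end Problem

/-! ### Cluster points and multipliers of the run. -/

variable {P : Problem n m} {p : Params} {s : Sequences n m}

section Multipliers

variable (hobj : ContDiff ℝ 2 P.obj) (hcon : ∀ j, ContDiff ℝ 2 (P.con j))
  (hind : P.GradientsIndependent) (hs : IsGenerated P p s) (hB : UniformlyPosDef s.B)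
  (hφ : ∀ᶠ k in atTop, P.phi (s.x k) = 0) (hd₀ : Tendsto s.d₀ atTop (𝓝 0))

include hs hB hd₀ in
theorem tendsto_B_d₀ : Tendsto (fun k => (s.B k).toEuclideanLin (s.d₀ k)) atTop (𝓝 0) := by
  obtain ⟨a, b, ha, hb, hab⟩ := hB
  refine squeeze_zero_norm (fun k => norm_apply_le_of_form_le
    (Matrix.isSymmetric_toEuclideanLin_iff.2 (hs.posDef k).isHermitian)
    (fun d => le_trans (by positivity) (hab k d).1) (fun d => (hab k d).2) (s.d₀ k)) ?_
  simpa using hd₀.norm.const_mul b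

include hobj hcon hind hs hB hd₀ in
-- The filter is arbitrary so as to cover ultrafilters at cluster points as well as the full
-- sequence.
theorem eventually_multiplier_mem {y : E n} {l : Filter ℕ} (hl : l ≤ atTop)
    (hy : Tendsto s.x l (𝓝 y)) :
    ∃ C, ∀ᶠ k in l, s.lam k ∈ Metric.closedBall (0 : Fin m → ℝ) C := by
  obtain ⟨C, hC, hbd⟩ := P.exists_multiplier_bound hobj hcon hind y
  refine ⟨C * ((1 + 1) * (1 + 1)), ?_⟩
  have hsmall : ∀ {v : ℕ → E n}, Tendsto v atTop (𝓝 0) → ∀ᶠ k in l, ‖v k‖ < 1 := fun hv =>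
    hl (hv.norm.eventually (gt_mem_nhds (by simp)))
  filter_upwards [hy.eventually hbd, hsmall hd₀, hsmall (tendsto_B_d₀ hs hB hd₀)]
    with k hk h1 h2
  have hm := hs.qp_multiplier k
  refine Problem.mem_closedBall_of_sum_le hm.nonneg
    ((hk _ _ _ hm.stationary hm.nonneg hm.complementary).trans ?_)
  gcongr

include hobj hcon hs hB hφ hd₀ in
theorem isKKTPair_of_tendsto_run {y : E n} {lam : Fin m → ℝ} {l : Filter ℕ} [l.NeBot]
    (hl : l ≤ atTop) (hy : Tendsto s.x l (𝓝 y)) (hlam : Tendsto s.lam l (𝓝 lam)) :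
    P.IsKKTPair y lam :=
  Problem.isKKTPair_of_tendsto hobj hcon hy ((tendsto_B_d₀ hs hB hd₀).mono_left hl)
    (hd₀.mono_left hl) hlam (Eventually.of_forall fun k => (hs.qp_multiplier k).stationary)
    ((hφ.filter_mono hl).mono fun _ h => P.phi_eq_zero_iff.1 h)
    (Eventually.of_forall fun k => (hs.qp_multiplier k).nonneg)
    ((hφ.filter_mono hl).mono fun k h j => by
      rw [← P.conBar_eq_con h j]; exact (hs.qp_multiplier k).complementary j)

include hobj hcon hind hs hB hφ hd₀ in
/-- Every cluster point of the iterates is a KKT point. -/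
theorem exists_isKKTPair_of_mapClusterPt {y : E n} (hy : MapClusterPt y atTop s.x) :
    ∃ lam, P.IsKKTPair y lam := by
  obtain ⟨U, hU, hUy⟩ := mapClusterPt_iff_ultrafilter.1 hy
  obtain ⟨C, hC⟩ := eventually_multiplier_mem hobj hcon hind hs hB hd₀ hU hUy
  obtain ⟨lam, -, hlam⟩ := (isCompact_closedBall (0 : Fin m → ℝ) C).ultrafilter_le_nhds
    (U.map s.lam) (le_principal_iff.2 hC)
  exact ⟨lam, isKKTPair_of_tendsto_run hobj hcon hs hB hφ hd₀ hU hUy hlam⟩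

include hobj hcon hind hs hB hφ hd₀ in
-- The multipliers eventually stay in a compact ball, and each of their cluster points is a KKT
-- multiplier at `y`, hence equal to `lam`.
theorem tendsto_multiplier {y : E n} {lam : Fin m → ℝ} (hy : Tendsto s.x atTop (𝓝 y))
    (hlam : P.IsKKTPair y lam) : Tendsto s.lam atTop (𝓝 lam) := by
  obtain ⟨C, hC⟩ := eventually_multiplier_mem hobj hcon hind hs hB hd₀ le_rfl hy
  refine (isCompact_closedBall (0 : Fin m → ℝ) C).tendsto_nhds_of_unique_mapClusterPt hC
    fun mu _ hmu => ?_
  obtain ⟨U, hU, hUmu⟩ := mapClusterPt_iff_ultrafilter.1 hmu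
  exact (isKKTPair_of_tendsto_run hobj hcon hs hB hφ hd₀ hU (hy.mono_left hU) hUmu).unique
    hcon hind hlam

end Multipliers

end SubfeasibleSQP

/-! ### The convergence theorem. -/

theorem theorem2 {n m : ℕ} (P : SubfeasibleSQP.Problem n m)
    (p : SubfeasibleSQP.Params) (s : SubfeasibleSQP.Sequences n m)
    (hobj : ContDiff ℝ 2 P.obj) (hcon : ∀ j, ContDiff ℝ 2 (P.con j))
    (hind : P.GradientsIndependent)
    (hs : SubfeasibleSQP.IsGenerated P p s)
    (hB : SubfeasibleSQP.UniformlyPosDef s.B)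
    (hbdd : Bornology.IsBounded (Set.range s.x))
    (xs : SubfeasibleSQP.E n) (hxs : MapClusterPt xs atTop s.x)
    (hssosc : ∀ lam, P.IsKKTPair xs lam → P.SSOSC xs lam) :
    (Tendsto s.d₀ atTop (𝓝 0) ∧ Tendsto s.d₁ atTop (𝓝 0) ∧ Tendsto s.dt atTop (𝓝 0) ∧
      Tendsto s.q atTop (𝓝 0) ∧ Tendsto s.d atTop (𝓝 0) ∧
      Tendsto (fun k => ‖s.x (k + 1) - s.x k‖) atTop (𝓝 0)) ∧
    Tendsto s.x atTop (𝓝 xs) ∧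
    (Tendsto (fun k => P.phi (s.x k)) atTop (𝓝 (P.phi xs)) ∧ P.phi xs = 0) ∧
    ∃ lams : Fin m → ℝ, P.IsKKTPair xs lams ∧ (∀ lam, P.IsKKTPair xs lam → lam = lams) ∧
      Tendsto s.lam atTop (𝓝 lams) := by
  obtain ⟨a, C, M, V, hr⟩ := SubfeasibleSQP.exists_runBounds hobj hcon hind hs hB hbdd
  have hd₀ := hr.tendsto_d₀ hs hobj.continuous hbdd
  have hφ := hr.eventually_feasible hs
  have hstep := hr.tendsto_step hs hd₀
  obtain ⟨lams, hlams⟩ :=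
    SubfeasibleSQP.exists_isKKTPair_of_mapClusterPt hobj hcon hind hs hB hφ hd₀ hxs
  have hx : Tendsto s.x atTop (𝓝 xs) := by
    refine SubfeasibleSQP.tendsto_of_isolated_mapClusterPt (by simpa only [dist_eq_norm] using hstep)
      hxs ?_
    have hiso := SubfeasibleSQP.Problem.eventually_not_isKKTPair hobj hcon hind hlams
      (hssosc lams hlams)
    obtain ⟨r, hr, hball⟩ := Metric.eventually_nhds_iff.1 (eventually_nhdsWithin_iff.1 hiso)
    refine ⟨r / 2, by positivity, fun y hy0 hyr hcl => ?_⟩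
    exact hball (by linarith) (dist_pos.1 hy0)
      (SubfeasibleSQP.exists_isKKTPair_of_mapClusterPt hobj hcon hind hs hB hφ hd₀ hcl)
  refine ⟨⟨hd₀, hr.tendsto_d₁ hs hd₀, hr.tendsto_dt hs hd₀, hr.tendsto_q hs hd₀,
    hr.tendsto_d hs hd₀, hstep⟩, hx, ⟨?_, hlams.phi_eq_zero⟩, lams, hlams,
    fun lam hlam => hlam.unique hcon hind hlams,
    SubfeasibleSQP.tendsto_multiplier hobj hcon hind hs hB hφ hd₀ hx hlams⟩
  rw [hlams.phi_eq_zero]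
  exact hr.tendsto_phi hs
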